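/- Let $d\ge 1$, let $\|\cdot\|$ and $\langle\cdot,\cdot\rangle$ be the Euclidean norm and inner product of $\mathbb R^d$, and let $\mathbb S^{d-1}$ be its unit sphere. **Setting.** Let $\sigma$ be a finite positive measure on $\mathbb S^{d-1}$ and let $k_x(r)\ge 0$ ($x\in\mathbb S^{d-1}$, $r>0$) be decreasing and continuous in $r$, continuous in $x$, with $\lim_{r\to0^+}r^2k_x(r)=0$ and $\lim_{r\to+\infty}k_x(r)=0$ for all $x$. Let $X$ be a random vector in $\mathbb R^d$ with law $\mu_X$, non-degenerate (i.e. $\mu_X$ is not carried by a proper affine subspace), and self-decomposable without Gaussian component, with parameter $b\in\mathbb R^d$ and Lévy measure $$\nu(du)=\mathbf 1_{(0,+\infty)}(r)\,\mathbf 1_{\mathbb S^{d-1}}(x)\,\frac{k_x(r)}{r}\,dr\,\sigma(dx)\qquad(u=rx),$$ that is, $\nu(\{0\})=0$, $\int(1\wedge\|u\|^2)\,\nu(du)<\infty$ and $$\mathbb E e^{i\langle X,\xi\rangle}=\exp\Big(i\langle b,\xi\rangle+\int_{\mathbb R^d}\big(e^{i\langle \xi,u\rangle}-1-i\langle\xi,u\rangle\mathbf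 1_{\|u\|\le1}\big)\nu(du)\Big),\quad \xi\in\mathbb R^d.$$ Assume that for some $\varepsilon\in(0,1)$, $\mathbb E\|X\|^\varepsilon<+\infty$, and that for some $\beta_1,\beta_2>0$ and $\beta_3\in(0,1)$ the following quantities are finite: $$\gamma_1=\sup_{t\ge0}e^{\beta_1t}\int_{(1,+\infty)\times\mathbb S^{d-1}}\frac{k_x(e^tr)}{r}\,dr\,\sigma(dx),\qquad \gamma_2=\sup_{t\ge0}e^{\beta_2t}\int_{(0,1)\times\mathbb S^{d-1}}r\,k_x(e^tr)\,dr\,\sigma(dx),$$ $$\gamma_3=\sup_{t\ge0}e^{-(1-\beta_3)t}\Big\|\int_{\mathbb S^{d-1}}x\Big(\int_1^{e^t}k_x(r)\,dr\Big)\sigma(dx)\Big\|.$$ For $t\ge0$ let $X_t$ be a random vector, with law $\mu_t$, whose characteristic function is $$\varphi_t(\xi)=\exp\Big(i\langle b,\xi\rangle(1-e^{-t})+\int_{(0,+\infty)\times\mathbb S^{d-1}}\big(e^{ir\langle x,\xi\rangle}-1-i\langle rx,\xi\rangle\mathbf 1_{r\le1}\big)\frac{k_x(r)-k_x(e^tr)}{r}\,dr\,\sigma(dx)-\int_{(0,+\infty)\times\mathbb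 S^{d-1}}i\langle rx,\xi\rangle\mathbf 1_{e^{-t}<r\le1}\frac{k_x(e^tr)}{r}\,dr\,\sigma(dx)\Big),$$ and assume $\sup_{t\ge0}\mathbb E\|X_t\|^\varepsilon<+\infty$. Set $P^\nu_t(h)(x)=\int_{\mathbb R^d}h(xe^{-t}+y)\,\mu_t(dy)$, $$\tilde b=b-\int_{\mathbb S^{d-1}}k_y(1)\,y\,\sigma(dy),\qquad \tilde\nu(du)=\mathbf 1_{(0,+\infty)}(r)\,\mathbf 1_{\mathbb S^{d-1}}(x)\,(-dk_x(r))\,\sigma(dx)\qquad(u=rx).$$ For $\ell\ge0$ let $M_\ell(f)=\sup_{x}\|\mathbf D^\ell f(x)\|_{op}$ (so $M_0(f)=\sup_x|f(x)|$), and let $\mathcal H_r$ be the set of $r$ times continuously differentiable $h:\mathbb R^d\to\mathbb R$ with $M_\ell(h)\le1$ for $0\le\ell\le r$. **Theorem.** (i) For every $h\in\mathcal H_1$ the function $$f_h(x)=-\int_0^{+\infty}\big(P^\nu_t(h)(x)-\mathbb E h(X)\big)\,dt,\qquad x\in\mathbb R^d,$$ is well defined (the integrand is integrable on $(0,+\infty)$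 for every $x$) and continuously differentiable on $\mathbb R^d$, and $M_1(f_h)\le1$. (ii) For every $h\in\mathcal H_2\cap\mathcal C_c^\infty(\mathbb R^d)$ the function $f_h$ is twice continuously differentiable on $\mathbb R^d$, $M_2(f_h)\le\frac12$, and for every $x\in\mathbb R^d$ $$\langle\tilde b-x,\nabla f_h(x)\rangle+\int_{\mathbb R^d}\big(f_h(x+u)-f_h(x)-\langle\nabla f_h(x),u\rangle\mathbf 1_{\|u\|\le1}\big)\,\tilde\nu(du)=h(x)-\mathbb E h(X),$$ where the integral converges absolutely. -/

import Mathlib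

open MeasureTheory Set Filter Topology
open scoped ENNReal

noncomputable section

/-- The Euclidean space `ℝ^d` (with its Euclidean norm and inner product). -/
abbrev Rd (d : ℕ) : Type := EuclideanSpace ℝ (Fin d)

/-- The Euclidean unit sphere of `ℝ^d`. -/
abbrev Sph (d : ℕ) : Type := Metric.sphere (0 : Rd d) 1

/-! ### Infinitely divisible laws -/

/-- A Lévy measure on `ℝ^d`. -/
def IsLevyMeasure {d : ℕ} (ν : Measure (Rd d)) : Prop :=
  ν {0} = 0 ∧ ∫⁻ u, ENNReal.ofReal (min 1 (‖u‖ ^ 2)) ∂ν < ⊤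

/-- `μ` is (the law of) an infinitely divisible random vector with triplet `(b, Sig, ν)`: its
characteristic function has the Lévy–Khintchine form, with truncation at the closed unit ball. -/
def IsID {d : ℕ} (μ : Measure (Rd d)) (b : Rd d) (Sig : Rd d →L[ℝ] Rd d)
    (ν : Measure (Rd d)) : Prop :=
  IsProbabilityMeasure μ ∧ Sig.IsPositive ∧ IsLevyMeasure ν ∧
    ∀ ξ : Rd d, charFun μ ξ =
      Complex.exp (Complex.I * (inner ℝ b ξ : ℝ) - (1 / 2 : ℂ) * (inner ℝ ξ (Sig ξ) : ℝ) +
        ∫ u, (Complex.exp (Complex.I * (inner ℝ ξ u : ℝ)) - 1 -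
          if ‖u‖ ≤ 1 then Complex.I * (inner ℝ ξ u : ℝ) else 0) ∂ν)

/-- A law on `ℝ^d` is non-degenerate if it is not carried by a proper affine subspace. -/
def IsNondegenerate {d : ℕ} (μ : Measure (Rd d)) : Prop :=
  ∀ A : AffineSubspace ℝ (Rd d), A ≠ ⊤ → ¬ ∀ᵐ x ∂μ, x ∈ A

/-! ### The radial functions `k_x(r)`, the Lévy measure `ν` and the Lévy measure `ν̃` -/

/-- A function `k_x(r)`, `x` in the unit sphere and `r ∈ (0, ∞)` (values at `r ≤ 0` are never
used), which is nonnegative, decreasing and continuous in `r`, continuous in `x`, with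
`r² k_x(r) → 0` as `r → 0⁺` and `k_x(r) → 0` as `r → ∞`. -/
structure KFunction (d : ℕ) where
  /-- the value `k_x(r)` -/
  toFun : Sph d → ℝ → ℝ
  nonneg : ∀ x r, 0 < r → 0 ≤ toFun x r
  antitone : ∀ x, AntitoneOn (toFun x) (Ioi 0)
  continuous_radial : ∀ x, ContinuousOn (toFun x) (Ioi 0)
  continuous_angular : ∀ r, 0 < r → Continuous fun x => toFun x r
  tendsto_zero : ∀ x, Tendsto (fun r => r ^ 2 * toFun x r) (𝓝[>] 0) (𝓝 0)
  tendsto_atTop : ∀ x, Tendsto (toFun x) atTop (𝓝 0)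

instance {d : ℕ} : CoeFun (KFunction d) fun _ => Sph d → ℝ → ℝ := ⟨KFunction.toFun⟩

/-- The measure `1_{(0,∞)}(r) dr σ(dx)` on `ℝ × S^{d-1}`. -/
def polarBase {d : ℕ} (σ : Measure (Sph d)) : Measure (ℝ × Sph d) :=
  (volume.restrict (Ioi 0)).prod σ

/-- `ν(du) = 1_{(0,∞)}(r) 1_{S^{d-1}}(x) (k_x(r)/r) dr σ(dx)`, in polar coordinates `u = r x`. -/
def polarLevy {d : ℕ} (σ : Measure (Sph d)) (k : KFunction d) : Measure (Rd d) :=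
  ((polarBase σ).withDensity fun p => ENNReal.ofReal (k p.2 p.1 / p.1)).map
    fun p => p.1 • (p.2 : Rd d)

namespace KFunction

variable {d : ℕ} (k : KFunction d)

/-- The increasing continuous function `s ↦ -k_x(e^s)` on `ℝ`. -/
def stieltjes (x : Sph d) : StieltjesFunction ℝ where
  toFun s := -k x (Real.exp s)
  mono' := fun s t hst => neg_le_neg <|
    k.antitone x (Real.exp_pos s) (Real.exp_pos t) (Real.exp_le_exp.2 hst)
  right_continuous' := fun s => by
    have h : Continuous fun s => k x (Real.exp s) :=
      (k.continuous_radial x).comp_continuous Real.continuous_exp fun s => Real.exp_pos s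
    exact h.neg.continuousAt.continuousWithinAt

/-- The Stieltjes measure `-dk_x(r)` on `(0, ∞)`, obtained from the Stieltjes measure of
`s ↦ -k_x(e^s)` through `r = e^s`. The two lemmas below characterize it. -/
def negD (x : Sph d) : Measure ℝ := (k.stieltjes x).measure.map Real.exp

theorem negD_Ioc (x : Sph d) {a b : ℝ} (ha : 0 < a) (hb : 0 < b) :
    k.negD x (Ioc a b) = ENNReal.ofReal (k x a - k x b) := by
  have h : Real.exp ⁻¹' Ioc a b = Ioc (Real.log a) (Real.log b) := by
    ext s
    simp only [mem_preimage, mem_Ioc, Real.log_lt_iff_lt_exp ha, Real.le_log_iff_exp_le hb]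
  rw [negD, Measure.map_apply Real.measurable_exp measurableSet_Ioc, h,
    StieltjesFunction.measure_Ioc]
  congr 1
  change -k x (Real.exp (Real.log b)) - -k x (Real.exp (Real.log a)) = _
  rw [Real.exp_log ha, Real.exp_log hb]
  ring

theorem negD_Iic_zero (x : Sph d) : k.negD x (Iic 0) = 0 := by
  have h : Real.exp ⁻¹' Iic 0 = ∅ := by
    ext s
    simpa using Real.exp_pos s
  rw [negD, Measure.map_apply Real.measurable_exp measurableSet_Iic, h, measure_empty]

theorem stieltjes_measure_eq_tsum (x : Sph d) {s : Set ℝ} (hs : MeasurableSet s) :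
    (k.stieltjes x).measure s =
      ∑' n : ℤ, (k.stieltjes x).measure.restrict (Ioc (n : ℝ) (n + 1)) s := by
  have hU : s = ⋃ n : ℤ, s ∩ Ioc (n : ℝ) (n + 1) := by
    rw [← inter_iUnion, iUnion_Ioc_intCast, inter_univ]
  conv_lhs => rw [hU]
  rw [measure_iUnion]
  · exact tsum_congr fun n => (Measure.restrict_apply hs).symm
  · intro m n hmn
    exact ((pairwise_disjoint_Ioc_intCast ℝ) hmn).mono inter_subset_right inter_subset_right
  · exact fun n => hs.inter measurableSet_Ioc

theorem measurable_stieltjes_measure : Measurable fun x => (k.stieltjes x).measure := by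
  have hfin : ∀ n : ℤ, Measurable fun x =>
      (k.stieltjes x).measure.restrict (Ioc (n : ℝ) (n + 1)) := by
    intro n
    have hIoc : ∀ a b : ℝ, Measurable fun x => (k.stieltjes x).measure (Ioc a b) := by
      intro a b
      simp only [StieltjesFunction.measure_Ioc]
      refine ENNReal.measurable_ofReal.comp (Measurable.sub ?_ ?_)
      · exact (k.continuous_angular _ (Real.exp_pos b)).measurable.neg
      · exact (k.continuous_angular _ (Real.exp_pos a)).measurable.neg
    have : ∀ x, IsFiniteMeasure ((k.stieltjes x).measure.restrict (Ioc (n : ℝ) (n + 1))) := by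
      intro x
      refine ⟨?_⟩
      rw [Measure.restrict_apply_univ, StieltjesFunction.measure_Ioc]
      exact ENNReal.ofReal_lt_top
    refine Measurable.measure_of_isPiSystem (borel_eq_generateFrom_Iic ℝ) isPiSystem_Iic ?_ ?_
    · rintro _ ⟨c, rfl⟩
      have h : Iic c ∩ Ioc (n : ℝ) (n + 1) = Ioc (n : ℝ) (min (n + 1) c) := by
        ext s
        simp only [mem_inter_iff, mem_Iic, mem_Ioc, le_min_iff]
        tauto
      simp only [Measure.restrict_apply measurableSet_Iic, h]
      exact hIoc _ _
    · simp only [Measure.restrict_apply_univ]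
      exact hIoc _ _
  refine Measure.measurable_of_measurable_coe _ fun s hs => ?_
  have h := fun x => k.stieltjes_measure_eq_tsum x hs
  simp only [h]
  exact Measurable.tsum fun n => (Measure.measurable_coe hs).comp (hfin n)

theorem measurable_negD : Measurable k.negD :=
  (Measure.measurable_map Real.exp Real.measurable_exp).comp k.measurable_stieltjes_measure

end KFunction

/-- `ν̃(du) = 1_{(0,∞)}(r) 1_{S^{d-1}}(x) (-dk_x(r)) σ(dx)`, in polar coordinates `u = r x`:
the mixture over `σ(dx)` of the images of `-dk_x(r)` under `r ↦ r x`. -/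
def tildeLevy {d : ℕ} (σ : Measure (Sph d)) (k : KFunction d) : Measure (Rd d) :=
  σ.bind fun x => (k.negD x).map fun r => r • (x : Rd d)

theorem measurable_tildeLevy_fiber {d : ℕ} (k : KFunction d) :
    Measurable fun x : Sph d => (k.negD x).map fun r => r • (x : Rd d) := by
  have hg : Measurable fun p : Sph d × ℝ => Real.exp p.2 • (p.1 : Rd d) := by fun_prop
  let κ : ProbabilityTheory.Kernel (Sph d) ℝ :=
    ⟨fun x => (k.stieltjes x).measure, k.measurable_stieltjes_measure⟩
  let η : ℤ → ProbabilityTheory.Kernel (Sph d) ℝ := fun n =>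
    κ.restrict (measurableSet_Ioc : MeasurableSet (Ioc (n : ℝ) (n + 1)))
  have hη : ∀ n, ProbabilityTheory.IsFiniteKernel (η n) := by
    intro n
    have hc : Continuous fun x => k x (Real.exp n) - k x (Real.exp (n + 1)) :=
      (k.continuous_angular _ (Real.exp_pos _)).sub (k.continuous_angular _ (Real.exp_pos _))
    obtain ⟨C, hC⟩ := (isCompact_range hc).bddAbove
    refine ⟨ENNReal.ofReal C, ENNReal.ofReal_lt_top, fun x => ?_⟩
    change (κ.restrict _ x) univ ≤ _
    rw [ProbabilityTheory.Kernel.restrict_apply, Measure.restrict_apply_univ]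
    change (k.stieltjes x).measure (Ioc (n : ℝ) (n + 1)) ≤ _
    rw [StieltjesFunction.measure_Ioc]
    refine ENNReal.ofReal_le_ofReal ?_
    have h := hC (mem_range_self x)
    change -k x (Real.exp (n + 1)) - -k x (Real.exp n) ≤ C
    linarith
  have hκ : κ = ProbabilityTheory.Kernel.sum η := by
    ext x s hs
    rw [ProbabilityTheory.Kernel.sum_apply' _ _ hs]
    exact k.stieltjes_measure_eq_tsum x hs
  have : ProbabilityTheory.IsSFiniteKernel κ := by
    rw [hκ]
    infer_instance
  refine Measure.measurable_of_measurable_coe _ fun s hs => ?_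
  have h := ProbabilityTheory.Kernel.measurable_kernel_prodMk_left (κ := κ) (hg hs)
  convert h using 2 with x
  rw [KFunction.negD, Measure.map_map (by fun_prop) Real.measurable_exp,
    Measure.map_apply (by fun_prop) hs]
  rfl

/-- `ν̃` integrates as the iterated integral `∫ σ(dx) ∫ f(r x) (-dk_x(r))`. -/
theorem lintegral_tildeLevy {d : ℕ} (σ : Measure (Sph d)) (k : KFunction d)
    {f : Rd d → ℝ≥0∞} (hf : Measurable f) :
    ∫⁻ u, f u ∂(tildeLevy σ k) = ∫⁻ x, ∫⁻ r, f (r • (x : Rd d)) ∂(k.negD x) ∂σ := by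
  rw [tildeLevy, Measure.lintegral_bind (measurable_tildeLevy_fiber k).aemeasurable
    hf.aemeasurable]
  refine lintegral_congr fun x => ?_
  rw [lintegral_map hf (by fun_prop)]

/-- `b̃ = b - ∫_{S^{d-1}} k_y(1) y σ(dy)`. -/
def tildeDrift {d : ℕ} (b : Rd d) (σ : Measure (Sph d)) (k : KFunction d) : Rd d :=
  b - ∫ y, k y 1 • (y : Rd d) ∂σ

/-! ### The quantities `γ₁, γ₂, γ₃` -/

/-- `γ₁ = sup_{t ≥ 0} e^{β₁ t} ∫_{(1,∞) × S^{d-1}} k_x(e^t r) / r dr σ(dx)`. -/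
def gammaOne {d : ℕ} (σ : Measure (Sph d)) (k : KFunction d) (β : ℝ) : ℝ≥0∞ :=
  ⨆ t : ℝ, ⨆ _ : 0 ≤ t, ENNReal.ofReal (Real.exp (β * t)) *
    ∫⁻ p in Ioi (1 : ℝ) ×ˢ univ, ENNReal.ofReal (k p.2 (Real.exp t * p.1) / p.1) ∂(polarBase σ)

/-- `γ₂ = sup_{t ≥ 0} e^{β₂ t} ∫_{(0,1) × S^{d-1}} r k_x(e^t r) dr σ(dx)`. -/
def gammaTwo {d : ℕ} (σ : Measure (Sph d)) (k : KFunction d) (β : ℝ) : ℝ≥0∞ :=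
  ⨆ t : ℝ, ⨆ _ : 0 ≤ t, ENNReal.ofReal (Real.exp (β * t)) *
    ∫⁻ p in Ioo (0 : ℝ) 1 ×ˢ univ, ENNReal.ofReal (p.1 * k p.2 (Real.exp t * p.1)) ∂(polarBase σ)

/-- `γ₃ = sup_{t ≥ 0} e^{-(1-β₃) t} ‖∫_{S^{d-1}} x (∫_1^{e^t} k_x(r) dr) σ(dx)‖`. -/
def gammaThree {d : ℕ} (σ : Measure (Sph d)) (k : KFunction d) (β : ℝ) : ℝ≥0∞ :=
  ⨆ t : ℝ, ⨆ _ : 0 ≤ t, ENNReal.ofReal (Real.exp (-(1 - β) * t) *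
    ‖∫ x, (∫ r in (1 : ℝ)..Real.exp t, k x r) • (x : Rd d) ∂σ‖)

/-! ### The random vectors `X_t` and the semigroup -/

/-- The characteristic function `φ_t` of `X_t`. -/
def phiT {d : ℕ} (b : Rd d) (σ : Measure (Sph d)) (k : KFunction d) (t : ℝ) (ξ : Rd d) : ℂ :=
  Complex.exp (Complex.I * (inner ℝ b ξ * (1 - Real.exp (-t)) : ℝ) +
    (∫ p, (Complex.exp (Complex.I * (p.1 * inner ℝ (p.2 : Rd d) ξ : ℝ)) - 1 -
        (if p.1 ≤ 1 then Complex.I * (p.1 * inner ℝ (p.2 : Rd d) ξ : ℝ) else 0)) *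
        ((k p.2 p.1 - k p.2 (Real.exp t * p.1)) / p.1 : ℝ) ∂(polarBase σ)) -
    ∫ p, (if Real.exp (-t) < p.1 ∧ p.1 ≤ 1 then
        Complex.I * (p.1 * inner ℝ (p.2 : Rd d) ξ : ℝ) else 0) *
        (k p.2 (Real.exp t * p.1) / p.1 : ℝ) ∂(polarBase σ))

/-- `P_t h (x) = ∫ h(x e^{-t} + y) μ_t(dy)`, for a family of laws `(μ_t)`. -/
def semigroupP {d : ℕ} (μ : ℝ → Measure (Rd d)) (t : ℝ) (h : Rd d → ℝ) (x : Rd d) : ℝ :=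
  ∫ y, h (Real.exp (-t) • x + y) ∂(μ t)

/-- `f_h(x) = -∫_0^∞ (P_t h (x) - E h(X)) dt`, where `X` has law `μX`. -/
def steinSol {d : ℕ} (μX : Measure (Rd d)) (μ : ℝ → Measure (Rd d)) (h : Rd d → ℝ)
    (x : Rd d) : ℝ :=
  -∫ t in Ioi (0 : ℝ), (semigroupP μ t h x - ∫ z, h z ∂μX)

/-! ### Smooth test functions -/

/-- `M_ℓ(h) = sup_x ‖D^ℓ h(x)‖_op`; in particular `M_0(h) = sup_x |h(x)|`. -/
def supDeriv {d : ℕ} (l : ℕ) (h : Rd d → ℝ) : ℝ≥0∞ :=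
  ⨆ x, ENNReal.ofReal ‖iteratedFDeriv ℝ l h x‖

/-- The class `H_r`: `r` times continuously differentiable functions `h` with `M_ℓ(h) ≤ 1` for
`0 ≤ ℓ ≤ r`. -/
def classH (d r : ℕ) : Set (Rd d → ℝ) :=
  {h | ContDiff ℝ r h ∧ ∀ l ≤ r, supDeriv l h ≤ 1}

/-- `f(x+u) - f(x) - ⟨∇f(x), u⟩ 1_{‖u‖ ≤ 1}`. -/
def jumpTerm {d : ℕ} (f : Rd d → ℝ) (x u : Rd d) : ℝ :=
  f (x + u) - f x - if ‖u‖ ≤ 1 then inner ℝ (gradient f x) u else 0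

end

open MeasureTheory Set Filter Topology
open scoped ENNReal

noncomputable section

/-! ### The Lévy measures `polarLevy` and `tildeLevy` and the flow linking them. -/

section

namespace KFunction

variable {d : ℕ} (k : KFunction d)

/-! Write ν̃ for `tildeLevy` and let ψ, ψ̃ be the Lévy–Khintchine exponents of (b, ν) and (b̃, ν̃).
Integration by parts in the radial variable shows that ν is the image of ds ⊗ ν̃ under (s, u) ↦
e^{-s}u (`map_prod_tildeLevy`). Hence ψ(ξ) = ∫₀^∞ ψ̃(e^{-s}ξ) ds, the shift from b to b̃ being
exactly the mismatch of the two truncations, and d/dt ψ(e^{-t}ξ) = -ψ̃(e^{-t}ξ)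
(`hasDerivAt_levyExponent_flow`).

A change of scale identifies φ_t(ξ) with exp(ψ(ξ) - ψ(e^{-t}ξ)) (`phiT_eq_exp_sub`), so e^{-t}X +
X_t has the law of X when the summands are independent. Then P_t h(x) - E h(X) is the mean over z ~
X of P_t h(x) - P_t h(z), which is at most min(2, e^{-t}‖x-z‖) ≤ 2e^{-εt}‖x-z‖^ε in absolute value;
the ε-moment of X thus gives exponential decay (`abs_semigroupP_sub_le`). Each spatial derivative of
P_t h produces a factor e^{-t}, and ∫e^{-t}dt = 1, ∫e^{-2t}dt = 1/2 are the constants of the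
derivative bounds.

For the equation, let A be the operator with drift b̃ - x and jump measure ν̃. On each mode
e^{i⟨ξ,x⟩} the derivative of ψ(e^{-t}ξ) gives ∂_t P_t = A P_t, and Fourier inversion extends this to
smooth compactly supported h (`hasDerivAt_flowOp_time`). Integrating over t from 0 to ∞ gives E h(X)
- h(x) = -A f_h(x). Exchanging the integrals in t and u requires the compensated jumps of P_t h to
be integrable for dt ⊗ ν̃, which is the purpose of `flowBound`. -/

theorem continuous_comp_exp (x : Sph d) : Continuous fun w => k x (Real.exp w) :=
  (k.continuous_radial x).comp_continuous Real.continuous_exp fun s => Real.exp_pos s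

/-- A Carathéodory function: continuous in one variable and measurable in the other. The logarithmic
variable avoids the uncontrolled values of `k` at r ≤ 0. -/
theorem measurable_uncurry_exp : Measurable fun p : ℝ × Sph d => k p.2 (Real.exp p.1) :=
  measurable_uncurry_of_continuous_of_measurable (u := fun w x => k x (Real.exp w))
    (fun x => k.continuous_comp_exp x)
    (fun w => (k.continuous_angular _ (Real.exp_pos w)).measurable)

theorem negD_Ioi (x : Sph d) {a : ℝ} (ha : 0 < a) :
    k.negD x (Ioi a) = ENNReal.ofReal (k x a) := by
  have h : Real.exp ⁻¹' Ioi a = Ioi (Real.log a) := by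
    ext s
    simp only [mem_preimage, mem_Ioi, Real.log_lt_iff_lt_exp ha]
  have ht : Tendsto (k.stieltjes x) atTop (𝓝 0) := by
    have := ((k.tendsto_atTop x).comp Real.tendsto_exp_atTop).neg
    rw [neg_zero] at this
    exact this
  rw [negD, Measure.map_apply Real.measurable_exp measurableSet_Ioi, h,
    StieltjesFunction.measure_Ioi _ ht]
  congr 1
  change 0 - -k x (Real.exp (Real.log a)) = _
  rw [Real.exp_log ha]
  ring

theorem stieltjes_measure_Ioi (x : Sph d) (w : ℝ) :
    (k.stieltjes x).measure (Ioi w) = ENNReal.ofReal (k x (Real.exp w)) := by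
  have ht : Tendsto (k.stieltjes x) atTop (𝓝 0) := by
    have := ((k.tendsto_atTop x).comp Real.tendsto_exp_atTop).neg
    rw [neg_zero] at this
    exact this
  rw [StieltjesFunction.measure_Ioi _ ht]
  congr 1
  change 0 - -k x (Real.exp w) = _
  ring

theorem negD_ae_pos (x : Sph d) : ∀ᵐ r ∂(k.negD x), 0 < r := by
  rw [ae_iff]
  have : {r : ℝ | ¬ 0 < r} = Iic 0 := by ext; simp
  rw [this, k.negD_Iic_zero]

/-- The measures `-dk_x(r)`, as a kernel from the sphere to `ℝ`. -/
def negDKernel : ProbabilityTheory.Kernel (Sph d) ℝ := ⟨k.negD, k.measurable_negD⟩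

/-- The Stieltjes measures of `s ↦ -k_x(e^s)`, as a kernel from the sphere to `ℝ`. -/
def stieltjesKernel : ProbabilityTheory.Kernel (Sph d) ℝ :=
  ⟨fun x => (k.stieltjes x).measure, k.measurable_stieltjes_measure⟩

/-- Each piece of the kernel over a unit interval has mass continuous in x, hence bounded on the
compact sphere. This is what makes Fubini available for ν̃. -/
instance : ProbabilityTheory.IsSFiniteKernel k.stieltjesKernel := by
  let η : ℤ → ProbabilityTheory.Kernel (Sph d) ℝ := fun n =>
    k.stieltjesKernel.restrict (measurableSet_Ioc : MeasurableSet (Ioc (n : ℝ) (n + 1)))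
  have hη : ∀ n, ProbabilityTheory.IsFiniteKernel (η n) := by
    intro n
    have hc : Continuous fun x => k x (Real.exp n) - k x (Real.exp (n + 1)) :=
      (k.continuous_angular _ (Real.exp_pos _)).sub (k.continuous_angular _ (Real.exp_pos _))
    obtain ⟨C, hC⟩ := (isCompact_range hc).bddAbove
    refine ⟨ENNReal.ofReal C, ENNReal.ofReal_lt_top, fun x => ?_⟩
    change (k.stieltjesKernel.restrict _ x) univ ≤ _
    rw [ProbabilityTheory.Kernel.restrict_apply, Measure.restrict_apply_univ]
    change (k.stieltjes x).measure (Ioc (n : ℝ) (n + 1)) ≤ _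
    rw [StieltjesFunction.measure_Ioc]
    refine ENNReal.ofReal_le_ofReal ?_
    have h := hC (mem_range_self x)
    change -k x (Real.exp (n + 1)) - -k x (Real.exp n) ≤ C
    linarith
  have hκ : k.stieltjesKernel = ProbabilityTheory.Kernel.sum η := by
    ext x s hs
    rw [ProbabilityTheory.Kernel.sum_apply' _ _ hs]
    exact k.stieltjes_measure_eq_tsum x hs
  rw [hκ]
  infer_instance

theorem negDKernel_eq_map : k.negDKernel = k.stieltjesKernel.map Real.exp := by
  ext x : 1
  rw [ProbabilityTheory.Kernel.map_apply _ Real.measurable_exp]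
  rfl

instance : ProbabilityTheory.IsSFiniteKernel k.negDKernel := by
  rw [negDKernel_eq_map]
  infer_instance

end KFunction

variable {d : ℕ} (σ : Measure (Sph d)) [IsFiniteMeasure σ] (k : KFunction d)

/-- This form as an image of a composition-product yields s-finiteness of ν̃ and gives access to
Bochner integrals, beyond the `lintegral` formula. -/
theorem tildeLevy_eq_map :
    tildeLevy σ k =
      (σ.compProd k.negDKernel).map fun p : Sph d × ℝ => p.2 • (p.1 : Rd d) := by
  have hm : Measurable fun p : Sph d × ℝ => p.2 • (p.1 : Rd d) := by fun_prop
  refine Measure.ext_of_lintegral _ fun f hf => ?_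
  rw [lintegral_tildeLevy σ k hf, lintegral_map hf hm,
    Measure.lintegral_compProd (f := fun p : Sph d × ℝ => f (p.2 • (p.1 : Rd d))) (hf.comp hm)]
  rfl

instance : SFinite (tildeLevy σ k) := by
  rw [tildeLevy_eq_map]
  infer_instance

theorem polarBase_eq_restrict :
    polarBase σ = ((volume : Measure ℝ).prod σ).restrict (Ioi 0 ×ˢ univ) := by
  rw [polarBase, ← Measure.prod_restrict, Measure.restrict_univ]

theorem polarBase_ae_pos : ∀ᵐ p ∂(polarBase σ), 0 < p.1 := by
  rw [polarBase_eq_restrict]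
  filter_upwards [ae_restrict_mem (measurableSet_Ioi.prod MeasurableSet.univ)] with p hp
  exact hp.1

instance : SFinite (polarBase σ) := by
  unfold polarBase; infer_instance

theorem aemeasurable_k_mul {c : ℝ} (hc : 0 < c) :
    AEMeasurable (fun p : ℝ × Sph d => k p.2 (c * p.1)) (polarBase σ) := by
  -- `exp ∘ log` is the identity on r > 0, which has full measure, and makes the representative
  -- measurable everywhere.
  refine ⟨fun p => k p.2 (Real.exp (Real.log (c * p.1))), ?_, ?_⟩
  · exact k.measurable_uncurry_exp.comp
      (g := fun p : ℝ × Sph d => k p.2 (Real.exp p.1))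
      (f := fun p : ℝ × Sph d => (Real.log (c * p.1), p.2)) (by fun_prop)
  · filter_upwards [polarBase_ae_pos σ] with p hp
    rw [Real.exp_log (by positivity)]

theorem aemeasurable_k : AEMeasurable (fun p : ℝ × Sph d => k p.2 p.1) (polarBase σ) := by
  simpa using aemeasurable_k_mul σ k one_pos

theorem lintegral_Ioi_eq_lintegral_exp (f : ℝ → ℝ≥0∞) :
    ∫⁻ r in Ioi (0 : ℝ), f r = ∫⁻ w, ENNReal.ofReal (Real.exp w) * f (Real.exp w) := by
  have := lintegral_image_eq_lintegral_abs_deriv_mul (s := univ) (f := Real.exp)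
    (f' := Real.exp) MeasurableSet.univ
    (fun x _ => (Real.hasDerivAt_exp x).hasDerivWithinAt) Real.exp_injective.injOn f
  rw [image_univ, Real.range_exp] at this
  rw [this, Measure.restrict_univ]
  simp only [Real.abs_exp]

/-- With r = e^w the factor 1/r cancels the Jacobian, leaving the density k_x(e^w) dw. -/
theorem lintegral_polarLevy {f : Rd d → ℝ≥0∞} (hf : Measurable f) :
    ∫⁻ u, f u ∂(polarLevy σ k) =
      ∫⁻ x, ∫⁻ w, f (Real.exp w • (x : Rd d)) * ENNReal.ofReal (k x (Real.exp w)) ∂volume ∂σ := by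
  have hm : Measurable fun p : ℝ × Sph d => p.1 • (p.2 : Rd d) := by fun_prop
  have hd : AEMeasurable (fun p : ℝ × Sph d => ENNReal.ofReal (k p.2 p.1 / p.1)) (polarBase σ) :=
    ((aemeasurable_k σ k).div measurable_fst.aemeasurable).ennreal_ofReal
  have hfm : AEMeasurable (fun p : ℝ × Sph d => f (p.1 • (p.2 : Rd d))) (polarBase σ) :=
    (hf.comp hm).aemeasurable
  rw [polarLevy, lintegral_map hf hm, lintegral_withDensity_eq_lintegral_mul₀ hd hfm, polarBase,
    lintegral_prod_symm _ (hd.mul hfm)]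
  refine lintegral_congr fun x => ?_
  rw [lintegral_Ioi_eq_lintegral_exp]
  refine lintegral_congr fun w => ?_
  have hw := Real.exp_pos w
  simp only [Pi.mul_apply]
  rw [← mul_assoc, ← ENNReal.ofReal_mul hw.le, mul_div_cancel₀ _ hw.ne', mul_comm]

/-- The Lévy measure of `X` is the image of `ds ⊗ ν̃` under `(s, u) ↦ e^{-s} u`. -/
theorem map_prod_tildeLevy :
    ((volume.restrict (Ioi (0 : ℝ))).prod (tildeLevy σ k)).map
      (fun p : ℝ × Rd d => Real.exp (-p.1) • p.2) = polarLevy σ k := by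
  have hm : Measurable fun p : ℝ × Rd d => Real.exp (-p.1) • p.2 := by fun_prop
  refine Measure.ext_of_lintegral _ fun f hf => ?_
  have hfm : Measurable fun p : ℝ × Rd d => f (Real.exp (-p.1) • p.2) := hf.comp hm
  have h1 : Measurable fun u : Rd d => ∫⁻ s in Ioi (0 : ℝ), f (Real.exp (-s) • u) :=
    Measurable.lintegral_prod_left' (f := fun p : ℝ × Rd d => f (Real.exp (-p.1) • p.2)) hfm
  rw [lintegral_polarLevy σ k hf, lintegral_map hf hm, lintegral_prod_symm _ hfm.aemeasurable,
    lintegral_tildeLevy σ k h1]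
  refine lintegral_congr fun x => ?_
  have h2 : Measurable fun r : ℝ =>
      ∫⁻ s in Ioi (0 : ℝ), f (Real.exp (-s) • r • (x : Rd d)) :=
    h1.comp (by fun_prop : Measurable fun r : ℝ => r • (x : Rd d))
  rw [KFunction.negD, lintegral_map h2 Real.measurable_exp]
  -- The substitution w = v - s carries s > 0 onto w < v.
  have h3 : ∀ v : ℝ, ∫⁻ s in Ioi (0 : ℝ), f (Real.exp (-s) • Real.exp v • (x : Rd d)) =
      ∫⁻ w, (Ioi w).indicator (fun _ => f (Real.exp w • (x : Rd d))) v := by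
    intro v
    rw [← lintegral_indicator measurableSet_Ioi, ← lintegral_sub_left_eq_self _ v]
    refine lintegral_congr fun s => ?_
    by_cases h : s < v
    · rw [indicator_of_mem (by simpa using h), indicator_of_mem (by simpa using h), smul_smul,
        ← Real.exp_add]
      congr 3
      ring
    · rw [indicator_of_notMem (by simpa using h), indicator_of_notMem (by simpa using h)]
  simp only [h3]
  -- Integration by parts as Tonelli: for fixed w, the Stieltjes mass of v > w is k_x(e^w), because
  -- k_x vanishes at infinity.
  rw [lintegral_lintegral_swap]
  · refine lintegral_congr fun w => ?_
    rw [lintegral_indicator measurableSet_Ioi, setLIntegral_const, k.stieltjes_measure_Ioi]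
  · refine Measurable.aemeasurable ?_
    have : MeasurableSet {p : ℝ × ℝ | p.2 < p.1} := measurableSet_lt measurable_snd measurable_fst
    refine (Measurable.indicator (f := fun p : ℝ × ℝ => f (Real.exp p.2 • (x : Rd d)))
      (hf.comp (by fun_prop)) this)

end

section

/-! ### Elementary bounds -/

/-- The mean value inequality for f - f'(x) on the segment from x to x + u. The sharp constant L/2
is not needed. -/
theorem norm_sub_sub_fderiv_le {E F : Type*} [NormedAddCommGroup E] [NormedSpace ℝ E]
    [NormedAddCommGroup F] [NormedSpace ℝ F] {f : E → F} {f' : E → E →L[ℝ] F}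
    (hf : ∀ x, HasFDerivAt f (f' x) x) {L : ℝ} (hL0 : 0 ≤ L)
    (hL : ∀ x y, ‖f' y - f' x‖ ≤ L * ‖y - x‖) (x u : E) :
    ‖f (x + u) - f x - f' x u‖ ≤ L * ‖u‖ ^ 2 := by
  have h := (convex_segment x (x + u)).norm_image_sub_le_of_norm_hasFDerivWithin_le'
    (f := f) (f' := f') (φ := f' x) (C := L * ‖u‖) (fun y _ => (hf y).hasFDerivWithinAt)
    (fun y hy => ?_) (left_mem_segment ℝ x (x + u)) (right_mem_segment ℝ x (x + u))
  · rw [add_sub_cancel_left] at h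
    calc _ ≤ L * ‖u‖ * ‖u‖ := h
      _ = L * ‖u‖ ^ 2 := by ring
  · refine (hL x y).trans (mul_le_mul_of_nonneg_left ?_ hL0)
    have := norm_sub_le_of_mem_segment hy
    rwa [add_sub_cancel_left] at this

theorem norm_exp_I_mul_sub_one_sub_le (z : ℝ) :
    ‖Complex.exp (Complex.I * z) - 1 - Complex.I * z‖ ≤ z ^ 2 := by
  have hd : ∀ x : ℝ, HasDerivAt (fun x : ℝ => Complex.exp (Complex.I * x))
      (Complex.exp (Complex.I * x) * Complex.I) x := by
    intro x
    have h : HasDerivAt (fun x : ℝ => Complex.I * (x : ℂ)) Complex.I x := by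
      simpa using (HasDerivAt.ofReal_comp (hasDerivAt_id x)).const_mul Complex.I
    exact h.cexp
  have h := norm_sub_sub_fderiv_le (f := fun x : ℝ => Complex.exp (Complex.I * x))
    (fun x => (hd x).hasFDerivAt) zero_le_one (fun x y => ?_) 0 z
  · simpa [mul_comm] using h
  · refine ContinuousLinearMap.opNorm_le_bound _ (by positivity) fun c => ?_
    rw [one_mul, sub_apply, ContinuousLinearMap.toSpanSingleton_apply,
      ContinuousLinearMap.toSpanSingleton_apply, ← smul_sub, ← sub_mul, norm_smul, norm_mul,
      Complex.norm_I, mul_one, mul_comm]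
    refine mul_le_mul_of_nonneg_right ?_ (norm_nonneg c)
    have : Complex.exp (Complex.I * y) - Complex.exp (Complex.I * x) =
        Complex.exp (Complex.I * x) * (Complex.exp (Complex.I * (y - x : ℝ)) - 1) := by
      rw [mul_sub, ← Complex.exp_add, mul_one]
      congr 2
      push_cast
      ring
    rw [this, norm_mul, Complex.norm_exp_I_mul_ofReal, one_mul]
    exact Real.norm_exp_I_mul_ofReal_sub_one_le

theorem norm_exp_I_mul_sub_one_le_two (z : ℝ) : ‖Complex.exp (Complex.I * z) - 1‖ ≤ 2 := by
  refine (norm_sub_le _ _).trans ?_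
  rw [Complex.norm_exp_I_mul_ofReal, norm_one]
  norm_num

variable {d : ℕ}

/-- The integrand `e^{i⟨ξ,u⟩} - 1 - i⟨ξ,u⟩ 1_{‖u‖ ≤ 1}` of the Lévy–Khintchine formula. -/
def levyKernel (ξ u : Rd d) : ℂ :=
  Complex.exp (Complex.I * (inner ℝ ξ u : ℝ)) - 1 -
    if ‖u‖ ≤ 1 then Complex.I * (inner ℝ ξ u : ℝ) else 0

theorem measurable_levyKernel : Measurable fun p : Rd d × Rd d => levyKernel p.1 p.2 := by
  unfold levyKernel
  refine Measurable.sub (by fun_prop) (Measurable.ite ?_ (by fun_prop) measurable_const)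
  exact measurableSet_le (by fun_prop) measurable_const

theorem measurable_levyKernel_right (ξ : Rd d) : Measurable (levyKernel ξ) := by
  unfold levyKernel
  refine Measurable.sub (by fun_prop) (Measurable.ite ?_ (by fun_prop) measurable_const)
  exact measurableSet_le (by fun_prop) measurable_const

theorem norm_levyKernel_le_sq (ξ : Rd d) {u : Rd d} (hu : ‖u‖ ≤ 1) :
    ‖levyKernel ξ u‖ ≤ ‖ξ‖ ^ 2 * ‖u‖ ^ 2 := by
  rw [levyKernel, if_pos hu]
  refine (norm_exp_I_mul_sub_one_sub_le _).trans ?_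
  rw [← mul_pow]
  exact sq_le_sq.2 ((abs_real_inner_le_norm ξ u).trans (le_abs_self _))

theorem norm_levyKernel_le_two (ξ : Rd d) {u : Rd d} (hu : 1 < ‖u‖) :
    ‖levyKernel ξ u‖ ≤ 2 := by
  rw [levyKernel, if_neg (not_le.2 hu), sub_zero]
  exact norm_exp_I_mul_sub_one_le_two _

theorem norm_levyKernel_le_mul (ξ : Rd d) {u : Rd d} (hu : 1 < ‖u‖) :
    ‖levyKernel ξ u‖ ≤ ‖ξ‖ * ‖u‖ := by
  rw [levyKernel, if_neg (not_le.2 hu), sub_zero]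
  exact Real.norm_exp_I_mul_ofReal_sub_one_le.trans (abs_real_inner_le_norm ξ u)

theorem norm_levyKernel_le (ξ u : Rd d) :
    ‖levyKernel ξ u‖ ≤ (‖ξ‖ ^ 2 + 2) * min 1 (‖u‖ ^ 2) := by
  by_cases hu : ‖u‖ ≤ 1
  · rw [min_eq_right (by nlinarith [norm_nonneg u])]
    exact (norm_levyKernel_le_sq ξ hu).trans (by nlinarith [sq_nonneg ‖u‖])
  · rw [not_le] at hu
    rw [min_eq_left (by nlinarith)]
    exact (norm_levyKernel_le_two ξ hu).trans (by nlinarith [sq_nonneg ‖ξ‖])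

theorem continuous_levyKernel_left (u : Rd d) : Continuous fun ξ => levyKernel ξ u := by
  unfold levyKernel
  split_ifs <;> fun_prop

/-- The Lévy–Khintchine exponent with drift `b`, Lévy measure `ν` and no Gaussian part. -/
def levyExponent (b : Rd d) (ν : Measure (Rd d)) (ξ : Rd d) : ℂ :=
  Complex.I * (inner ℝ b ξ : ℝ) + ∫ u, levyKernel ξ u ∂ν

section

variable {ν : Measure (Rd d)}

theorem integrable_min_one_sq (hν : ∫⁻ u, ENNReal.ofReal (min 1 (‖u‖ ^ 2)) ∂ν < ⊤) :
    Integrable (fun u => min 1 (‖u‖ ^ 2)) ν := by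
  refine ⟨by fun_prop, ?_⟩
  rw [hasFiniteIntegral_iff_ofReal (ae_of_all _ fun u => by positivity)]
  exact hν

theorem integrable_levyKernel (hν : Integrable (fun u => min 1 (‖u‖ ^ 2)) ν) (ξ : Rd d) :
    Integrable (levyKernel ξ) ν :=
  (hν.const_mul (‖ξ‖ ^ 2 + 2)).mono' (measurable_levyKernel_right ξ).aestronglyMeasurable
    (ae_of_all _ fun u => norm_levyKernel_le ξ u)

theorem continuous_levyExponent (b : Rd d) (hν : Integrable (fun u => min 1 (‖u‖ ^ 2)) ν) :
    Continuous (levyExponent b ν) := by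
  refine Continuous.add (by fun_prop) (continuous_iff_continuousAt.2 fun ξ₀ => ?_)
  refine continuousAt_of_dominated (bound := fun u => ((‖ξ₀‖ + 1) ^ 2 + 2) * min 1 (‖u‖ ^ 2))
    (Eventually.of_forall fun ξ => (measurable_levyKernel_right ξ).aestronglyMeasurable)
    ?_ (hν.const_mul _) (ae_of_all _ fun u => (continuous_levyKernel_left u).continuousAt)
  filter_upwards [Metric.ball_mem_nhds ξ₀ one_pos] with ξ hξ
  refine ae_of_all _ fun u => (norm_levyKernel_le ξ u).trans ?_
  have h1 : ‖ξ‖ ≤ ‖ξ₀‖ + 1 := by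
    have := norm_sub_norm_le ξ ξ₀
    rw [mem_ball_iff_norm] at hξ
    linarith
  gcongr

end

/-! ### Integrability along the flow `u ↦ e^{-s} u` -/

/-- A bound for the jump terms of the flow, integrable for `ds ⊗ ν̃`. -/
def flowBound (p : ℝ × Rd d) : ℝ :=
  min 1 (‖Real.exp (-p.1) • p.2‖ ^ 2) +
    if Real.exp (-p.1) * ‖p.2‖ ≤ 1 ∧ 1 < ‖p.2‖ then Real.exp (-p.1) * ‖p.2‖ else 0

/-- The hypotheses are the natural estimates of a compensated jump: Taylor for small u, boundedness
and Lipschitz continuity for large u. If ‖u‖ ≤ 1, the flowed vector is also small and the quadratic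
term suffices. If ‖u‖ > 1, the Lipschitz estimate is used once the flow has entered the unit ball,
the constant before that. It serves both Fourier modes and jumps of the semigroup. -/
theorem le_flowBound {a C s : ℝ} {u : Rd d} (hs : 0 ≤ s) (hC : 0 ≤ C)
    (h1 : ‖u‖ ≤ 1 → a ≤ C * (Real.exp (-s) * ‖u‖) ^ 2)
    (h2 : 1 < ‖u‖ → a ≤ C) (h3 : 1 < ‖u‖ → a ≤ C * (Real.exp (-s) * ‖u‖)) :
    a ≤ C * flowBound (s, u) := by
  have he : Real.exp (-s) ≤ 1 := Real.exp_le_one_iff.2 (by linarith)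
  have he0 := Real.exp_pos (-s)
  have hn : ‖Real.exp (-s) • u‖ = Real.exp (-s) * ‖u‖ := by
    rw [norm_smul, Real.norm_of_nonneg he0.le]
  unfold flowBound
  simp only [hn]
  have h0 : 0 ≤ Real.exp (-s) * ‖u‖ := by positivity
  by_cases hu : ‖u‖ ≤ 1
  · have hle : Real.exp (-s) * ‖u‖ ≤ 1 := mul_le_one₀ he (norm_nonneg u) hu
    rw [if_neg (by simp [hu]), min_eq_right (pow_le_one₀ h0 hle), add_zero]
    exact h1 hu
  · rw [not_le] at hu
    by_cases hle : Real.exp (-s) * ‖u‖ ≤ 1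
    · rw [if_pos ⟨hle, hu⟩]
      refine (h3 hu).trans (mul_le_mul_of_nonneg_left ?_ hC)
      have : 0 ≤ min 1 ((Real.exp (-s) * ‖u‖) ^ 2) := by positivity
      linarith
    · rw [if_neg (by simp [hle])]
      rw [not_le] at hle
      rw [min_eq_left (by nlinarith), add_zero, mul_one]
      exact h2 hu

theorem measurable_flow : Measurable fun p : ℝ × Rd d => Real.exp (-p.1) • p.2 := by fun_prop

section

variable {ν νt : Measure (Rd d)}

theorem integrable_min_flow
    (hmap : ((volume.restrict (Ioi (0 : ℝ))).prod νt).map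
      (fun p : ℝ × Rd d => Real.exp (-p.1) • p.2) = ν)
    (hν : Integrable (fun u => min 1 (‖u‖ ^ 2)) ν) :
    Integrable (fun p : ℝ × Rd d => min 1 (‖Real.exp (-p.1) • p.2‖ ^ 2))
      ((volume.restrict (Ioi (0 : ℝ))).prod νt) := by
  rw [← hmap] at hν
  exact hν.comp_measurable measurable_flow

/-- For s in (0, 1) the contraction costs at most e²: min(1, ‖u‖²) ≤ e² min(1, ‖e^{-s}u‖²). The left
side does not depend on s and (0, 1) has positive length, so integrability descends to the second
factor. -/
theorem integrable_min_one_sq_of_flow [SFinite νt]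
    (hmap : ((volume.restrict (Ioi (0 : ℝ))).prod νt).map
      (fun p : ℝ × Rd d => Real.exp (-p.1) • p.2) = ν)
    (hν : Integrable (fun u => min 1 (‖u‖ ^ 2)) ν) :
    Integrable (fun u => min 1 (‖u‖ ^ 2)) νt := by
  have h := (integrable_min_flow hmap hν).mono_measure
    (Measure.prod_mono (Measure.restrict_mono (Ioo_subset_Ioi_self : Ioo (0 : ℝ) 1 ⊆ Ioi 0) le_rfl)
      le_rfl)
  have h2 : Integrable (fun p : ℝ × Rd d => min 1 (‖p.2‖ ^ 2))
      ((volume.restrict (Ioo (0 : ℝ) 1)).prod νt) := by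
    refine (h.const_mul (Real.exp 2)).mono' (by fun_prop) ?_
    have hae : ∀ᵐ p ∂((volume.restrict (Ioo (0 : ℝ) 1)).prod νt), p.1 ∈ Ioo (0 : ℝ) 1 :=
      Measure.quasiMeasurePreserving_fst.ae (ae_restrict_mem measurableSet_Ioo)
    filter_upwards [hae] with p hp
    have he : Real.exp 2 * Real.exp (-p.1) ^ 2 = Real.exp (2 - 2 * p.1) := by
      rw [← Real.exp_nat_mul, ← Real.exp_add]
      congr 1
      push_cast
      ring
    have he1 : 1 ≤ Real.exp (2 - 2 * p.1) := Real.one_le_exp (by linarith [hp.2])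
    have he2 : 1 ≤ Real.exp 2 := Real.one_le_exp (by norm_num)
    rw [Real.norm_of_nonneg (by positivity), norm_smul, Real.norm_of_nonneg (Real.exp_pos _).le,
      mul_pow, mul_min_of_nonneg _ _ (Real.exp_pos 2).le, ← mul_assoc, he, mul_one]
    exact min_le_min he2 (le_mul_of_one_le_left (by positivity) he1)
  refine h2.of_comp_snd fun h0 => ?_
  have := congrArg (fun m : Measure ℝ => m univ) h0
  simp at this

theorem indicator_flow_tail {u : Rd d} (hu : 1 < ‖u‖) (s : ℝ) :
    (if Real.exp (-s) * ‖u‖ ≤ 1 ∧ 1 < ‖u‖ then Real.exp (-s) else 0) =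
      (Ici (Real.log ‖u‖)).indicator (fun s => Real.exp (-s)) s := by
  have hu0 : 0 < ‖u‖ := by linarith
  have : (Real.exp (-s) * ‖u‖ ≤ 1 ∧ 1 < ‖u‖) ↔ s ∈ Ici (Real.log ‖u‖) := by
    rw [mem_Ici, Real.log_le_iff_le_exp hu0, Real.exp_neg, inv_mul_le_one₀ (Real.exp_pos s)]
    exact and_iff_left hu
  simp only [this, indicator_apply]

theorem integrableOn_flow_tail {u : Rd d} (hu : 1 < ‖u‖) :
    IntegrableOn (fun s => if Real.exp (-s) * ‖u‖ ≤ 1 ∧ 1 < ‖u‖ then Real.exp (-s) else 0)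
      (Ioi 0) := by
  simp only [indicator_flow_tail hu]
  exact (integrableOn_exp_neg_Ioi 0).indicator measurableSet_Ici

theorem integral_flow_tail {u : Rd d} (hu : 1 < ‖u‖) :
    ∫ s in Ioi (0 : ℝ), (if Real.exp (-s) * ‖u‖ ≤ 1 ∧ 1 < ‖u‖ then Real.exp (-s) else 0) =
      ‖u‖⁻¹ := by
  simp only [indicator_flow_tail hu]
  have hI : Ioi (0 : ℝ) ∩ Ici (Real.log ‖u‖) = Ici (Real.log ‖u‖) :=
    inter_eq_right.2 fun s hs => (Real.log_pos hu).trans_le hs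
  rw [setIntegral_indicator measurableSet_Ici, hI, integral_Ici_eq_integral_Ioi,
    integral_exp_neg_Ioi, Real.exp_neg, Real.exp_log (by linarith)]

theorem measurableSet_flow_tail :
    MeasurableSet {p : ℝ × Rd d | Real.exp (-p.1) * ‖p.2‖ ≤ 1 ∧ 1 < ‖p.2‖} :=
  (measurableSet_le (f := fun p : ℝ × Rd d => Real.exp (-p.1) * ‖p.2‖) (by fun_prop)
    measurable_const).inter (measurableSet_lt (g := fun p : ℝ × Rd d => ‖p.2‖) measurable_const
      (by fun_prop))

/-- For ‖u‖ > 1 the flow enters the unit ball at s = log ‖u‖, and from then on e^{-s}‖u‖ integrates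
to exactly 1. Only the finiteness of ν̃ on {‖u‖ > 1} is needed, not a first moment. -/
theorem integrable_flow_tail [SFinite νt] (hνt : Integrable (fun u => min 1 (‖u‖ ^ 2)) νt) :
    Integrable (fun p : ℝ × Rd d =>
      if Real.exp (-p.1) * ‖p.2‖ ≤ 1 ∧ 1 < ‖p.2‖ then Real.exp (-p.1) * ‖p.2‖ else 0)
      ((volume.restrict (Ioi (0 : ℝ))).prod νt) := by
  have hm : Measurable fun p : ℝ × Rd d =>
      if Real.exp (-p.1) * ‖p.2‖ ≤ 1 ∧ 1 < ‖p.2‖ then Real.exp (-p.1) * ‖p.2‖ else 0 :=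
    Measurable.ite measurableSet_flow_tail (by fun_prop) measurable_const
  have heq : ∀ s : ℝ, ∀ u : Rd d,
      (if Real.exp (-s) * ‖u‖ ≤ 1 ∧ 1 < ‖u‖ then Real.exp (-s) * ‖u‖ else 0) =
      (if Real.exp (-s) * ‖u‖ ≤ 1 ∧ 1 < ‖u‖ then Real.exp (-s) else 0) * ‖u‖ := by
    intro s u
    split_ifs <;> simp
  refine (integrable_prod_iff' hm.aestronglyMeasurable).2 ⟨ae_of_all _ fun u => ?_, ?_⟩
  · by_cases hu : 1 < ‖u‖
    · simp only [heq]
      exact (integrableOn_flow_tail hu).mul_const _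
    · simp [hu]
  · refine hνt.mono' hm.stronglyMeasurable.norm.integral_prod_left'.aestronglyMeasurable ?_
    refine ae_of_all _ fun u => ?_
    by_cases hu : 1 < ‖u‖
    · have h1 : ∀ s : ℝ,
          ‖if Real.exp (-s) * ‖u‖ ≤ 1 ∧ 1 < ‖u‖ then Real.exp (-s) * ‖u‖ else 0‖ =
          (if Real.exp (-s) * ‖u‖ ≤ 1 ∧ 1 < ‖u‖ then Real.exp (-s) else 0) * ‖u‖ := by
        intro s
        rw [← heq, Real.norm_of_nonneg]
        positivity
      simp only [h1]
      rw [integral_mul_const, integral_flow_tail hu, inv_mul_cancel₀ (by linarith), norm_one,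
        min_eq_left (by nlinarith)]
    · simp only [hu, and_false, if_false, norm_zero, integral_zero]
      positivity

theorem integrable_flowBound [SFinite νt]
    (hmap : ((volume.restrict (Ioi (0 : ℝ))).prod νt).map
      (fun p : ℝ × Rd d => Real.exp (-p.1) • p.2) = ν)
    (hν : Integrable (fun u => min 1 (‖u‖ ^ 2)) ν) :
    Integrable flowBound ((volume.restrict (Ioi (0 : ℝ))).prod νt) :=
  (integrable_min_flow hmap hν).add
    (integrable_flow_tail (integrable_min_one_sq_of_flow hmap hν))

/-! ### The exponent of `X` as an integral along the flow -/

theorem ae_fst_pos [SFinite νt] : ∀ᵐ p ∂((volume.restrict (Ioi (0 : ℝ))).prod νt), 0 < p.1 :=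
  Measure.quasiMeasurePreserving_fst.ae (ae_restrict_mem measurableSet_Ioi)

/-- Moving e^{-s} from ξ to u leaves the exponential unchanged but moves the truncation. The two
cut-offs disagree only where ‖u‖ > 1 and ‖e^{-s}u‖ ≤ 1. -/
theorem levyKernel_flow (ξ : Rd d) {s : ℝ} (hs : 0 ≤ s) (u : Rd d) :
    levyKernel (Real.exp (-s) • ξ) u = levyKernel ξ (Real.exp (-s) • u) +
      Complex.I * (((if Real.exp (-s) * ‖u‖ ≤ 1 ∧ 1 < ‖u‖ then Real.exp (-s) else 0) *
        inner ℝ ξ u : ℝ) : ℂ) := by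
  have he : Real.exp (-s) ≤ 1 := Real.exp_le_one_iff.2 (by linarith)
  have he0 := Real.exp_pos (-s)
  have hn : ‖Real.exp (-s) • u‖ = Real.exp (-s) * ‖u‖ := by
    rw [norm_smul, Real.norm_of_nonneg he0.le]
  unfold levyKernel
  simp only [hn, real_inner_smul_left, real_inner_smul_right]
  by_cases hu : ‖u‖ ≤ 1
  · have hle : Real.exp (-s) * ‖u‖ ≤ 1 := mul_le_one₀ he (norm_nonneg u) hu
    simp [hu, hle, not_lt.2 hu]
  · have hu' := not_le.1 hu
    by_cases hle : Real.exp (-s) * ‖u‖ ≤ 1 <;> simp [hu, hle, hu']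

theorem integrable_levyKernel_flow [SFinite νt]
    (hmap : ((volume.restrict (Ioi (0 : ℝ))).prod νt).map
      (fun p : ℝ × Rd d => Real.exp (-p.1) • p.2) = ν)
    (hν : Integrable (fun u => min 1 (‖u‖ ^ 2)) ν) (ξ : Rd d) :
    Integrable (fun p : ℝ × Rd d => levyKernel (Real.exp (-p.1) • ξ) p.2)
      ((volume.restrict (Ioi (0 : ℝ))).prod νt) := by
  have hm : Measurable fun p : ℝ × Rd d => levyKernel (Real.exp (-p.1) • ξ) p.2 :=
    measurable_levyKernel.comp (g := fun p : Rd d × Rd d => levyKernel p.1 p.2)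
      (f := fun p : ℝ × Rd d => (Real.exp (-p.1) • ξ, p.2)) (by fun_prop)
  refine ((integrable_flowBound hmap hν).const_mul (‖ξ‖ ^ 2 + ‖ξ‖ + 2)).mono'
    hm.aestronglyMeasurable ?_
  filter_upwards [ae_fst_pos] with p hp
  have hn : ‖Real.exp (-p.1) • ξ‖ = Real.exp (-p.1) * ‖ξ‖ := by
    rw [norm_smul, Real.norm_of_nonneg (Real.exp_pos _).le]
  have h0 := norm_nonneg ξ
  refine le_flowBound hp.le (by positivity) (fun hu => ?_) (fun hu => ?_) (fun hu => ?_)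
  · refine (norm_levyKernel_le_sq _ hu).trans ?_
    rw [hn]
    calc (Real.exp (-p.1) * ‖ξ‖) ^ 2 * ‖p.2‖ ^ 2
        = ‖ξ‖ ^ 2 * (Real.exp (-p.1) * ‖p.2‖) ^ 2 := by ring
      _ ≤ _ := by gcongr; linarith
  · exact (norm_levyKernel_le_two _ hu).trans (by nlinarith)
  · refine (norm_levyKernel_le_mul _ hu).trans ?_
    rw [hn]
    calc Real.exp (-p.1) * ‖ξ‖ * ‖p.2‖ = ‖ξ‖ * (Real.exp (-p.1) * ‖p.2‖) := by ring
      _ ≤ _ := by gcongr; nlinarith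

/-- The main term of `levyKernel_flow` is pushed forward to ν. The truncation correction, integrated
first in s, becomes a drift in the direction u/‖u‖. -/
theorem integral_levyKernel_flow [SFinite νt]
    (hmap : ((volume.restrict (Ioi (0 : ℝ))).prod νt).map
      (fun p : ℝ × Rd d => Real.exp (-p.1) • p.2) = ν)
    (hν : Integrable (fun u => min 1 (‖u‖ ^ 2)) ν) (ξ : Rd d) :
    ∫ s in Ioi (0 : ℝ), ∫ u, levyKernel (Real.exp (-s) • ξ) u ∂νt =
      ∫ u, levyKernel ξ u ∂ν +
        Complex.I * ((∫ u, (if 1 < ‖u‖ then ‖u‖⁻¹ * inner ℝ ξ u else 0) ∂νt : ℝ) : ℂ) := by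
  have hνt := integrable_min_one_sq_of_flow hmap hν
  have hi := integrable_levyKernel_flow hmap hν ξ
  have h1 : Integrable (fun p : ℝ × Rd d => levyKernel ξ (Real.exp (-p.1) • p.2))
      ((volume.restrict (Ioi (0 : ℝ))).prod νt) := by
    have := integrable_levyKernel hν ξ
    rw [← hmap] at this
    exact this.comp_measurable measurable_flow
  have h2 : Integrable (fun p : ℝ × Rd d =>
      (if Real.exp (-p.1) * ‖p.2‖ ≤ 1 ∧ 1 < ‖p.2‖ then Real.exp (-p.1) else 0) * inner ℝ ξ p.2)
      ((volume.restrict (Ioi (0 : ℝ))).prod νt) := by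
    refine ((integrable_flow_tail hνt).const_mul ‖ξ‖).mono' ?_ (ae_of_all _ fun p => ?_)
    · exact (Measurable.mul (Measurable.ite measurableSet_flow_tail (by fun_prop) measurable_const)
        (by fun_prop)).aestronglyMeasurable
    · split_ifs
      · rw [norm_mul, Real.norm_of_nonneg (Real.exp_pos _).le]
        calc _ ≤ Real.exp (-p.1) * (‖ξ‖ * ‖p.2‖) := by
              gcongr; exact abs_real_inner_le_norm _ _
          _ = _ := by ring
      · simp
  have h2' : Integrable (fun p : ℝ × Rd d => Complex.I *
      (((if Real.exp (-p.1) * ‖p.2‖ ≤ 1 ∧ 1 < ‖p.2‖ then Real.exp (-p.1) else 0) *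
        inner ℝ ξ p.2 : ℝ) : ℂ)) ((volume.restrict (Ioi (0 : ℝ))).prod νt) :=
    h2.ofReal.const_mul _
  rw [← integral_prod _ hi]
  have h3 : ∫ p, levyKernel (Real.exp (-p.1) • ξ) p.2
        ∂((volume.restrict (Ioi (0 : ℝ))).prod νt) =
      ∫ p, (levyKernel ξ (Real.exp (-p.1) • p.2) + Complex.I *
        (((if Real.exp (-p.1) * ‖p.2‖ ≤ 1 ∧ 1 < ‖p.2‖ then Real.exp (-p.1) else 0) *
          inner ℝ ξ p.2 : ℝ) : ℂ)) ∂((volume.restrict (Ioi (0 : ℝ))).prod νt) := by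
    refine integral_congr_ae ?_
    filter_upwards [ae_fst_pos] with p hp
    exact levyKernel_flow ξ hp.le p.2
  rw [h3, integral_add h1 h2', integral_const_mul, integral_complex_ofReal,
    ← hmap, integral_map measurable_flow.aemeasurable
      (measurable_levyKernel_right ξ).aestronglyMeasurable, integral_prod_symm _ h2]
  congr 4
  ext u
  dsimp only
  by_cases hu : 1 < ‖u‖
  · rw [integral_mul_const, integral_flow_tail hu, if_pos hu]
  · simp [hu]

theorem levyExponent_exp_smul (bt ξ : Rd d) (s : ℝ) :
    levyExponent bt νt (Real.exp (-s) • ξ) =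
      ((Real.exp (-s) : ℝ) : ℂ) * (Complex.I * (inner ℝ bt ξ : ℝ)) +
        ∫ u, levyKernel (Real.exp (-s) • ξ) u ∂νt := by
  unfold levyExponent
  rw [real_inner_smul_right]
  push_cast
  ring

theorem integrableOn_levyExponent_flow [SFinite νt] (bt : Rd d)
    (hmap : ((volume.restrict (Ioi (0 : ℝ))).prod νt).map
      (fun p : ℝ × Rd d => Real.exp (-p.1) • p.2) = ν)
    (hν : Integrable (fun u => min 1 (‖u‖ ^ 2)) ν) (ξ : Rd d) :
    IntegrableOn (fun s => levyExponent bt νt (Real.exp (-s) • ξ)) (Ioi 0) := by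
  simp only [levyExponent_exp_smul]
  refine Integrable.add ?_ (integrable_levyKernel_flow hmap hν ξ).integral_prod_left
  exact ((integrableOn_exp_neg_Ioi 0).ofReal (𝕜 := ℂ)).mul_const _

theorem integral_levyExponent_flow [SFinite νt] {b bt : Rd d}
    (hmap : ((volume.restrict (Ioi (0 : ℝ))).prod νt).map
      (fun p : ℝ × Rd d => Real.exp (-p.1) • p.2) = ν)
    (hν : Integrable (fun u => min 1 (‖u‖ ^ 2)) ν)
    (hb : ∀ ξ, inner ℝ b ξ =
      inner ℝ bt ξ + ∫ u, (if 1 < ‖u‖ then ‖u‖⁻¹ * inner ℝ ξ u else 0) ∂νt) (ξ : Rd d) :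
    ∫ s in Ioi (0 : ℝ), levyExponent bt νt (Real.exp (-s) • ξ) = levyExponent b ν ξ := by
  simp only [levyExponent_exp_smul]
  rw [integral_add ?_ (integrable_levyKernel_flow hmap hν ξ).integral_prod_left,
    integral_mul_const, integral_complex_ofReal, integral_exp_neg_Ioi_zero,
    integral_levyKernel_flow hmap hν, levyExponent, hb]
  · push_cast
    ring
  · exact ((integrableOn_exp_neg_Ioi 0).ofReal (𝕜 := ℂ)).mul_const _

/-- Since ψ(ξ) = ∫₀^∞ ψ̃(e^{-s}ξ) ds, shifting s by t gives ψ(e^{-t}ξ) = ∫_t^∞ ψ̃(e^{-s}ξ) ds, and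
the fundamental theorem of calculus applies. -/
theorem hasDerivAt_levyExponent_flow [SFinite νt] {b bt : Rd d}
    (hmap : ((volume.restrict (Ioi (0 : ℝ))).prod νt).map
      (fun p : ℝ × Rd d => Real.exp (-p.1) • p.2) = ν)
    (hν : Integrable (fun u => min 1 (‖u‖ ^ 2)) ν)
    (hb : ∀ ξ, inner ℝ b ξ =
      inner ℝ bt ξ + ∫ u, (if 1 < ‖u‖ then ‖u‖⁻¹ * inner ℝ ξ u else 0) ∂νt) (ξ : Rd d) (t : ℝ) :
    HasDerivAt (fun t => levyExponent b ν (Real.exp (-t) • ξ))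
      (-levyExponent bt νt (Real.exp (-t) • ξ)) t := by
  have hc : Continuous fun s : ℝ => levyExponent bt νt (Real.exp (-s) • ξ) :=
    (continuous_levyExponent bt (integrable_min_one_sq_of_flow hmap hν)).comp (by fun_prop)
  have hi := integrableOn_levyExponent_flow bt hmap hν ξ
  have heq : ∀ t : ℝ, levyExponent b ν (Real.exp (-t) • ξ) =
      (∫ s in Ioi (0 : ℝ), levyExponent bt νt (Real.exp (-s) • ξ)) -
        ∫ s in (0 : ℝ)..t, levyExponent bt νt (Real.exp (-s) • ξ) := by
    intro t
    -- For negative t a compact interval [t, 0] has to be added, where continuity is enough.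
    have hit : IntegrableOn (fun s => levyExponent bt νt (Real.exp (-s) • ξ)) (Ioi t) := by
      have := (hc.integrableOn_Icc (a := t) (b := 0)).union hi
      refine this.mono_set fun s hs => ?_
      by_cases h0 : s ≤ 0
      · exact Or.inl ⟨le_of_lt hs, h0⟩
      · exact Or.inr (not_le.1 h0)
    rw [← intervalIntegral.integral_Ioi_sub_Ioi' hi hit, sub_sub_cancel,
      ← integral_levyExponent_flow hmap hν hb]
    have := (measurePreserving_add_right volume t).setIntegral_preimage_emb
      (measurableEmbedding_addRight t) (fun s => levyExponent bt νt (Real.exp (-s) • ξ)) (Ioi t)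
    rw [preimage_add_const_Ioi, sub_self] at this
    rw [← this]
    refine setIntegral_congr_fun measurableSet_Ioi fun s _ => ?_
    simp only [smul_smul, ← Real.exp_add]
    congr 3
    ring
  simp only [funext heq]
  exact (intervalIntegral.integral_hasDerivAt_right (hc.intervalIntegrable _ _)
    (hc.stronglyMeasurableAtFilter _ _) hc.continuousAt).const_sub _

end

end

section

/-! ### Drift and characteristic exponents in polar coordinates -/

theorem integrable_min_one_sq_polarLevy {d : ℕ} (σ : Measure (Sph d)) (k : KFunction d)
    (hν : IsLevyMeasure (polarLevy σ k)) :
    Integrable (fun u => min 1 (‖u‖ ^ 2)) (polarLevy σ k) :=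
  integrable_min_one_sq hν.2

variable {d : ℕ} (σ : Measure (Sph d)) [IsFiniteMeasure σ] (k : KFunction d)

theorem norm_sph (x : Sph d) : ‖(x : Rd d)‖ = 1 := by simp

theorem integrable_min_one_sq_tildeLevy (hν : IsLevyMeasure (polarLevy σ k)) :
    Integrable (fun u => min 1 (‖u‖ ^ 2)) (tildeLevy σ k) :=
  integrable_min_one_sq_of_flow (map_prod_tildeLevy σ k)
    (integrable_min_one_sq_polarLevy σ k hν)

/-- In polar coordinates u/‖u‖ = x, and -dk_x gives (1, ∞) the mass k_x(1). This accounts for the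
form of `tildeDrift`. -/
theorem integral_tildeLevy_tail (hν : IsLevyMeasure (polarLevy σ k)) (ξ : Rd d) :
    ∫ u, (if 1 < ‖u‖ then ‖u‖⁻¹ * inner ℝ ξ u else 0) ∂(tildeLevy σ k) =
      inner ℝ (∫ y, k y 1 • (y : Rd d) ∂σ) ξ := by
  have hmeas : Measurable fun u : Rd d => if 1 < ‖u‖ then ‖u‖⁻¹ * inner ℝ ξ u else 0 :=
    Measurable.ite (measurableSet_lt measurable_const measurable_norm) (by fun_prop)
      measurable_const
  have hm : Measurable fun p : Sph d × ℝ => p.2 • (p.1 : Rd d) := by fun_prop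
  have hi : Integrable (fun u : Rd d => if 1 < ‖u‖ then ‖u‖⁻¹ * inner ℝ ξ u else 0)
      (tildeLevy σ k) := by
    refine ((integrable_min_one_sq_tildeLevy σ k hν).const_mul ‖ξ‖).mono'
      hmeas.aestronglyMeasurable (ae_of_all _ fun u => ?_)
    split_ifs with hu
    · rw [min_eq_left (by nlinarith), norm_mul, norm_inv, norm_norm, mul_one,
        inv_mul_le_iff₀ (by linarith), mul_comm]
      exact abs_real_inner_le_norm ξ u
    · rw [norm_zero]
      positivity
  rw [tildeLevy_eq_map] at hi ⊢
  rw [integral_map hm.aemeasurable hmeas.aestronglyMeasurable,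
    Measure.integral_compProd (f := fun p : Sph d × ℝ => if 1 < ‖p.2 • (p.1 : Rd d)‖ then
      ‖p.2 • (p.1 : Rd d)‖⁻¹ * inner ℝ ξ (p.2 • (p.1 : Rd d)) else 0) (hi.comp_measurable hm),
    real_inner_comm]
  have hc : Continuous fun y : Sph d => k y 1 • (y : Rd d) :=
    (k.continuous_angular 1 one_pos).smul continuous_subtype_val
  have hci : Integrable (fun y : Sph d => k y 1 • (y : Rd d)) σ :=
    hc.integrable_of_hasCompactSupport (HasCompactSupport.of_compactSpace _)
  rw [← integral_inner hci]
  refine integral_congr_ae (ae_of_all _ fun x => ?_)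
  have h1 : (fun r : ℝ => if 1 < ‖r • (x : Rd d)‖ then
      ‖r • (x : Rd d)‖⁻¹ * inner ℝ ξ (r • (x : Rd d)) else 0) =ᵐ[k.negDKernel x]
      (Ioi 1).indicator fun _ => inner ℝ ξ (x : Rd d) := by
    filter_upwards [k.negD_ae_pos x] with r hr
    rw [norm_smul, norm_sph, mul_one, Real.norm_of_nonneg hr.le, real_inner_smul_right,
      inv_mul_cancel_left₀ hr.ne']
    rfl
  change ∫ r, (if 1 < ‖r • (x : Rd d)‖ then
      ‖r • (x : Rd d)‖⁻¹ * inner ℝ ξ (r • (x : Rd d)) else 0) ∂(k.negDKernel x) = _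
  rw [integral_congr_ae h1, integral_indicator measurableSet_Ioi, setIntegral_const]
  simp only
  rw [real_inner_smul_right, smul_eq_mul, Measure.real]
  congr 1
  change (k.negD x (Ioi 1)).toReal = _
  rw [k.negD_Ioi x one_pos, ENNReal.toReal_ofReal (k.nonneg x 1 one_pos)]

theorem inner_drift (hν : IsLevyMeasure (polarLevy σ k)) (b ξ : Rd d) :
    inner ℝ b ξ = inner ℝ (tildeDrift b σ k) ξ +
      ∫ u, (if 1 < ‖u‖ then ‖u‖⁻¹ * inner ℝ ξ u else 0) ∂(tildeLevy σ k) := by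
  rw [integral_tildeLevy_tail σ k hν, ← inner_add_left, tildeDrift, sub_add_cancel]

theorem charFun_eq_exp_levyExponent {μX : Measure (Rd d)} {b : Rd d} {ν : Measure (Rd d)}
    (hX : IsID μX b 0 ν) (ξ : Rd d) : charFun μX ξ = Complex.exp (levyExponent b ν ξ) := by
  rw [hX.2.2.2 ξ, levyExponent]
  simp [levyKernel]

/-! ### Scaling of the radial variable -/

theorem map_mul_restrict_Ioi {c : ℝ} (hc : 0 < c) :
    (volume.restrict (Ioi (0 : ℝ))).map (c * ·) =
      ENNReal.ofReal c⁻¹ • volume.restrict (Ioi (0 : ℝ)) := by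
  have hpre : (c * ·) ⁻¹' Ioi (0 : ℝ) = Ioi 0 := by
    ext r
    simp [hc]
  conv_lhs => rw [← hpre]
  rw [← Measure.restrict_map (measurable_const_mul c) measurableSet_Ioi,
    Real.map_volume_mul_left hc.ne', abs_of_pos (inv_pos.2 hc), Measure.restrict_smul]

theorem map_scale_polarBase {c : ℝ} (hc : 0 < c) :
    (polarBase σ).map (fun p : ℝ × Sph d => (c * p.1, p.2)) =
      ENNReal.ofReal c⁻¹ • polarBase σ := by
  have h := Measure.map_prod_map (volume.restrict (Ioi (0 : ℝ))) σ
    (measurable_const_mul c) measurable_id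
  rw [map_mul_restrict_Ioi hc, Measure.map_id, Measure.prod_smul_left] at h
  exact h.symm

theorem integrable_scale_polarBase {c : ℝ} (hc : 0 < c) {F : ℝ × Sph d → ℂ}
    (hF : Integrable F (polarBase σ)) :
    Integrable (fun p => F (c * p.1, p.2)) (polarBase σ) := by
  have h : Integrable F (ENNReal.ofReal c⁻¹ • polarBase σ) :=
    hF.smul_measure ENNReal.ofReal_ne_top
  rw [← map_scale_polarBase σ hc] at h
  exact h.comp_measurable (by fun_prop)

theorem integral_scale_polarBase {c : ℝ} (hc : 0 < c) {F : ℝ × Sph d → ℂ}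
    (hF : Integrable F (polarBase σ)) :
    ∫ p, F (c * p.1, p.2) ∂(polarBase σ) = (c⁻¹ : ℝ) * ∫ p, F p ∂(polarBase σ) := by
  have h : Integrable F (ENNReal.ofReal c⁻¹ • polarBase σ) :=
    hF.smul_measure ENNReal.ofReal_ne_top
  rw [← map_scale_polarBase σ hc] at h
  rw [← integral_map (φ := fun p : ℝ × Sph d => (c * p.1, p.2)) (by fun_prop)
    h.aestronglyMeasurable, map_scale_polarBase σ hc, integral_smul_measure,
    ENNReal.toReal_ofReal (inv_pos.2 hc).le, Complex.real_smul]

theorem measurable_polar : Measurable fun p : ℝ × Sph d => p.1 • (p.2 : Rd d) := by fun_prop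

theorem aemeasurable_polar_density :
    AEMeasurable (fun p : ℝ × Sph d => ENNReal.ofReal (k p.2 p.1 / p.1)) (polarBase σ) :=
  ((aemeasurable_k σ k).div measurable_fst.aemeasurable).ennreal_ofReal

theorem ae_toReal_polar_density : ∀ᵐ p ∂(polarBase σ),
    (ENNReal.ofReal (k p.2 p.1 / p.1)).toReal = k p.2 p.1 / p.1 := by
  filter_upwards [polarBase_ae_pos σ] with p hp
  exact ENNReal.toReal_ofReal (div_nonneg (k.nonneg _ _ hp) hp.le)

theorem integral_polarLevy {F : Rd d → ℂ} (hF : Measurable F) :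
    ∫ u, F u ∂(polarLevy σ k) =
      ∫ p, F (p.1 • (p.2 : Rd d)) * (k p.2 p.1 / p.1 : ℝ) ∂(polarBase σ) := by
  rw [polarLevy, integral_map measurable_polar.aemeasurable hF.aestronglyMeasurable,
    integral_withDensity_eq_integral_toReal_smul₀ (aemeasurable_polar_density σ k)
      (ae_of_all _ fun p => ENNReal.ofReal_lt_top)]
  refine integral_congr_ae ?_
  filter_upwards [ae_toReal_polar_density σ k] with p hp
  rw [hp, Complex.real_smul, mul_comm]

theorem integrable_polarLevy {F : Rd d → ℂ} (hF : Integrable F (polarLevy σ k)) :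
    Integrable (fun p => F (p.1 • (p.2 : Rd d)) * (k p.2 p.1 / p.1 : ℝ)) (polarBase σ) := by
  rw [polarLevy] at hF
  have h := hF.comp_measurable measurable_polar
  rw [integrable_withDensity_iff_integrable_smul₀' (aemeasurable_polar_density σ k)
    (ae_of_all _ fun p => ENNReal.ofReal_lt_top)] at h
  refine h.congr ?_
  filter_upwards [ae_toReal_polar_density σ k] with p hp
  rw [hp, Complex.real_smul, mul_comm]
  rfl

theorem levyKernel_polar (ξ : Rd d) {p : ℝ × Sph d} (hp : 0 < p.1) :
    levyKernel ξ (p.1 • (p.2 : Rd d)) =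
      Complex.exp (Complex.I * (p.1 * inner ℝ (p.2 : Rd d) ξ : ℝ)) - 1 -
        (if p.1 ≤ 1 then Complex.I * (p.1 * inner ℝ (p.2 : Rd d) ξ : ℝ) else 0) := by
  rw [levyKernel, norm_smul, norm_sph, mul_one, Real.norm_of_nonneg hp.le, real_inner_smul_right,
    real_inner_comm]

/-- In the exponent at e^{-t}ξ, replace r by e^t r: the density becomes k_x(e^t r)/r and the cut-off
becomes r ≤ e^{-t}. The discrepancy with r ≤ 1 is the last integral in `phiT`. -/
theorem phiT_eq_exp_sub (hν : IsLevyMeasure (polarLevy σ k)) (b : Rd d) {t : ℝ} (ht : 0 ≤ t)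
    (ξ : Rd d) :
    phiT b σ k t ξ = Complex.exp (levyExponent b (polarLevy σ k) ξ -
      levyExponent b (polarLevy σ k) (Real.exp (-t) • ξ)) := by
  have hint := fun ξ => integrable_levyKernel (integrable_min_one_sq_polarLevy σ k hν) ξ
  have hpos := Real.exp_pos t
  set A : ℝ × Sph d → ℂ := fun p => levyKernel ξ (p.1 • (p.2 : Rd d)) with hA
  set a : ℝ × Sph d → ℂ := fun p => ((k p.2 p.1 / p.1 : ℝ) : ℂ) with ha
  set a' : ℝ × Sph d → ℂ := fun p => ((k p.2 (Real.exp t * p.1) / p.1 : ℝ) : ℂ) with ha'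
  set D : ℝ × Sph d → ℂ := fun p => if Real.exp (-t) < p.1 ∧ p.1 ≤ 1 then
    Complex.I * (p.1 * inner ℝ (p.2 : Rd d) ξ : ℝ) else 0 with hD
  have hAa : Integrable (fun p => A p * a p) (polarBase σ) := integrable_polarLevy σ k (hint ξ)
  have hAm : Measurable A := (measurable_levyKernel_right ξ).comp measurable_polar
  -- As t ≥ 0 and k_x is decreasing, k_x(e^t r) ≤ k_x(r), so the scaled density is dominated.
  have hAa' : Integrable (fun p => A p * a' p) (polarBase σ) := by
    refine hAa.mono ?_ ?_
    · refine hAm.aestronglyMeasurable.mul (AEMeasurable.aestronglyMeasurable ?_)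
      exact Complex.measurable_ofReal.comp_aemeasurable
        ((aemeasurable_k_mul σ k hpos).div measurable_fst.aemeasurable)
    · filter_upwards [polarBase_ae_pos σ] with p hp
      have hle : p.1 ≤ Real.exp t * p.1 := le_mul_of_one_le_left hp.le (Real.one_le_exp ht)
      have hp' : 0 < Real.exp t * p.1 := by positivity
      rw [norm_mul, norm_mul]
      refine mul_le_mul_of_nonneg_left ?_ (norm_nonneg _)
      rw [ha, ha', Complex.norm_real, Complex.norm_real,
        Real.norm_of_nonneg (div_nonneg (k.nonneg _ _ hp') hp.le),
        Real.norm_of_nonneg (div_nonneg (k.nonneg _ _ hp) hp.le)]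
      exact div_le_div_of_nonneg_right (k.antitone p.2 hp hp' hle) hp.le
  set F : ℝ × Sph d → ℂ := fun p =>
    levyKernel (Real.exp (-t) • ξ) (p.1 • (p.2 : Rd d)) * (k p.2 p.1 / p.1 : ℝ) with hF
  have hFi : Integrable F (polarBase σ) := integrable_polarLevy σ k (hint (Real.exp (-t) • ξ))
  have hFs : (fun p => Real.exp t * F (Real.exp t * p.1, p.2)) =ᵐ[polarBase σ]
      fun p => A p * a' p + D p * a' p := by
    filter_upwards [polarBase_ae_pos σ] with p hp
    have hp' : 0 < Real.exp t * p.1 := by positivity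
    have hk : ((Real.exp t : ℝ) : ℂ) *
        ((k p.2 (Real.exp t * p.1) / (Real.exp t * p.1) : ℝ) : ℂ) = a' p := by
      rw [ha', ← Complex.ofReal_mul]
      congr 1
      field_simp
    have hAD : levyKernel (Real.exp (-t) • ξ) ((Real.exp t * p.1) • (p.2 : Rd d)) =
        A p + D p := by
      have hiff : Real.exp t * p.1 ≤ 1 ↔ p.1 ≤ Real.exp (-t) := by
        rw [Real.exp_neg, ← one_div, le_div_iff₀ hpos, mul_comm]
      have he : Real.exp (-t) ≤ 1 := Real.exp_le_one_iff.2 (by linarith)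
      have hm : Real.exp t * p.1 * (Real.exp (-t) * inner ℝ (p.2 : Rd d) ξ) =
          p.1 * inner ℝ (p.2 : Rd d) ξ := by
        rw [Real.exp_neg]
        field_simp
      rw [levyKernel_polar (Real.exp (-t) • ξ) (p := (Real.exp t * p.1, p.2)) hp', hA, hD]
      simp only [levyKernel_polar ξ hp, real_inner_smul_right, hm, hiff]
      by_cases h1 : p.1 ≤ 1
      · by_cases h2 : p.1 ≤ Real.exp (-t)
        · simp [h1, h2, not_lt.2 h2]
        · simp [h1, h2, not_le.1 h2]
      · have h2 : ¬ p.1 ≤ Real.exp (-t) := fun h => h1 (h.trans he)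
        simp [h1, h2]
    rw [hF]
    simp only
    rw [hAD, mul_left_comm, hk, add_mul]
  have hADi : Integrable (fun p => A p * a' p + D p * a' p) (polarBase σ) :=
    ((integrable_scale_polarBase σ hpos hFi).const_mul _).congr hFs
  -- Obtained as a difference of integrable functions, the sum being the rescaled `F`.
  have hDi : Integrable (fun p => D p * a' p) (polarBase σ) := by
    refine (hADi.sub hAa').congr (ae_of_all _ fun p => ?_)
    simp
  have hscale : ∫ p, F p ∂(polarBase σ) =
      ∫ p, A p * a' p ∂(polarBase σ) + ∫ p, D p * a' p ∂(polarBase σ) := by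
    rw [← integral_add hAa' hDi, ← integral_congr_ae hFs, integral_const_mul,
      integral_scale_polarBase σ hpos hFi, ← mul_assoc, ← Complex.ofReal_mul,
      mul_inv_cancel₀ hpos.ne', Complex.ofReal_one, one_mul]
  have hmain : ∫ p, (Complex.exp (Complex.I * (p.1 * inner ℝ (p.2 : Rd d) ξ : ℝ)) - 1 -
        (if p.1 ≤ 1 then Complex.I * (p.1 * inner ℝ (p.2 : Rd d) ξ : ℝ) else 0)) *
        ((k p.2 p.1 - k p.2 (Real.exp t * p.1)) / p.1 : ℝ) ∂(polarBase σ) =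
      ∫ p, A p * a p ∂(polarBase σ) - ∫ p, A p * a' p ∂(polarBase σ) := by
    rw [← integral_sub hAa hAa']
    refine integral_congr_ae ?_
    filter_upwards [polarBase_ae_pos σ] with p hp
    simp only [hA, ha, ha', levyKernel_polar ξ hp, sub_div, Complex.ofReal_sub]
    ring
  have e1 : ∫ u, levyKernel ξ u ∂(polarLevy σ k) = ∫ p, A p * a p ∂(polarBase σ) :=
    integral_polarLevy σ k (measurable_levyKernel_right ξ)
  have e2 : ∫ u, levyKernel (Real.exp (-t) • ξ) u ∂(polarLevy σ k) =
      ∫ p, F p ∂(polarBase σ) :=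
    integral_polarLevy σ k (measurable_levyKernel_right _)
  have hDint : ∫ p, (if Real.exp (-t) < p.1 ∧ p.1 ≤ 1 then
        Complex.I * (p.1 * inner ℝ (p.2 : Rd d) ξ : ℝ) else 0) *
        (k p.2 (Real.exp t * p.1) / p.1 : ℝ) ∂(polarBase σ) =
      ∫ p, D p * a' p ∂(polarBase σ) := rfl
  rw [phiT, hmain, hDint, levyExponent, levyExponent, e1, e2, hscale, real_inner_smul_right]
  congr 1
  push_cast
  ring

end

section

/-! ### Weakly continuous families of laws -/

variable {d : ℕ}

theorem continuous_probabilityMeasure_of_charFun {m : ℝ → ProbabilityMeasure (Rd d)}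
    (hc : ∀ ξ : Rd d, Continuous fun t => charFun (m t : Measure (Rd d)) ξ) : Continuous m := by
  refine continuous_iff_continuousAt.2 fun t => ?_
  refine tendsto_of_seq_tendsto fun v hv => ?_
  exact ProbabilityMeasure.tendsto_of_tendsto_charFun fun ξ => ((hc ξ).tendsto t).comp hv

/-- Lévy's continuity theorem makes the family weakly continuous. Closed sets form a generating
π-system, and their masses are limits of integrals of thickened indicators, which are continuous in
t. -/
theorem measurable_of_continuous_charFun {m : ℝ → Measure (Rd d)}
    [hm : ∀ t, IsProbabilityMeasure (m t)] (hc : ∀ ξ, Continuous fun t => charFun (m t) ξ) :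
    Measurable m := by
  let m' : ℝ → ProbabilityMeasure (Rd d) := fun t => ⟨m t, hm t⟩
  have hcont : Continuous m' := continuous_probabilityMeasure_of_charFun hc
  refine Measurable.measure_of_isPiSystem_of_isProbabilityMeasure
    (S := {s | IsClosed s}) ?_ isPiSystem_isClosed fun F hF => ?_
  · rw [BorelSpace.measurable_eq (α := Rd d), borel_eq_generateFrom_isClosed]
  · have hδ : ∀ n : ℕ, (0 : ℝ) < 1 / ((n : ℝ) + 1) := fun n => by positivity
    refine measurable_of_tendsto_metrizable (f := fun (n : ℕ) t =>
      ∫⁻ y, (thickenedIndicator (hδ n) F y : ℝ≥0∞) ∂(m t)) (fun n => ?_) ?_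
    · exact ((ProbabilityMeasure.continuous_lintegral_boundedContinuousFunction
        (thickenedIndicator (hδ n) F)).comp hcont).measurable
    · rw [tendsto_pi_nhds]
      exact fun t => tendsto_lintegral_thickenedIndicator_of_isClosed (m t) hF hδ
        tendsto_one_div_add_atTop_nhds_zero_nat

/-! ### Self-decomposability and convergence of the semigroup to equilibrium. -/

section

variable {μX : Measure (Rd d)} [IsProbabilityMeasure μX] {μ : ℝ → Measure (Rd d)} {ψ : Rd d → ℂ}

theorem exists_kernel_of_exponent (hμ : ∀ t, 0 ≤ t → IsProbabilityMeasure (μ t))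
    (hψ : Continuous ψ)
    (hφ : ∀ t, 0 ≤ t → ∀ ξ, charFun (μ t) ξ = Complex.exp (ψ ξ - ψ (Real.exp (-t) • ξ))) :
    ∃ κ : ProbabilityTheory.Kernel ℝ (Rd d),
      ProbabilityTheory.IsMarkovKernel κ ∧ ∀ t, 0 ≤ t → κ t = μ t := by
  -- Nothing is known about `μ t` for t < 0, so the family is frozen there at its time-zero law.
  have hm : ∀ t, IsProbabilityMeasure (μ (max t 0)) := fun t => hμ _ (le_max_right _ _)
  have hmeas : Measurable fun t => μ (max t 0) := by
    refine measurable_of_continuous_charFun fun ξ => ?_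
    simp only [hφ _ (le_max_right _ _)]
    fun_prop
  exact ⟨⟨fun t => μ (max t 0), hmeas⟩, ⟨hm⟩, fun t ht => by
    change μ (max t 0) = μ t
    rw [max_eq_left ht]⟩

theorem eq_dirac_zero_of_exponent (hμ : ∀ t, 0 ≤ t → IsProbabilityMeasure (μ t))
    (hφ : ∀ t, 0 ≤ t → ∀ ξ, charFun (μ t) ξ = Complex.exp (ψ ξ - ψ (Real.exp (-t) • ξ))) :
    μ 0 = Measure.dirac 0 := by
  have := hμ 0 le_rfl
  refine Measure.ext_of_charFun ?_
  ext ξ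
  rw [hφ 0 le_rfl, charFun_dirac]
  simp

/-- Self-decomposability, read on characteristic functions: the terms ψ(e^{-t}ξ) cancel. -/
theorem conv_eq_of_exponent (hX : ∀ ξ, charFun μX ξ = Complex.exp (ψ ξ))
    (hμ : ∀ t, 0 ≤ t → IsProbabilityMeasure (μ t))
    (hφ : ∀ t, 0 ≤ t → ∀ ξ, charFun (μ t) ξ = Complex.exp (ψ ξ - ψ (Real.exp (-t) • ξ)))
    {t : ℝ} (ht : 0 ≤ t) : (μX.map (Real.exp (-t) • ·)).conv (μ t) = μX := by
  have := hμ t ht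
  have : IsProbabilityMeasure (μX.map (Real.exp (-t) • ·)) :=
    Measure.isProbabilityMeasure_map (by fun_prop)
  refine Measure.ext_of_charFun ?_
  ext ξ
  rw [charFun_conv, charFun_map_smul, hX, hX, hφ t ht, ← Complex.exp_add]
  congr 1
  ring

theorem integral_eq_of_conv {ρ : Measure (Rd d)} [IsProbabilityMeasure ρ] {c : ℝ}
    (h : (μX.map (c • ·)).conv ρ = μX) {g : Rd d → ℝ} (hg : Continuous g) {B : ℝ}
    (hB : ∀ x, |g x| ≤ B) :
    ∫ z, g z ∂μX = ∫ z, ∫ y, g (c • z + y) ∂ρ ∂μX := by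
  have : IsProbabilityMeasure (μX.map (c • ·)) :=
    Measure.isProbabilityMeasure_map (by fun_prop)
  have hi : Integrable g ((μX.map (c • ·)).conv ρ) :=
    Integrable.of_bound hg.aestronglyMeasurable B (ae_of_all _ hB)
  conv_lhs => rw [← h]
  rw [integral_conv hi, integral_map (by fun_prop)]
  exact (StronglyMeasurable.integral_prod_right (f := fun x y => g (x + y))
    (hg.comp continuous_add).stronglyMeasurable).aestronglyMeasurable

/-- Interpolates between boundedness and Lipschitz continuity, so that an ε-moment can replace a
first moment. -/
theorem min_two_le_rpow {a ε : ℝ} (ha : 0 ≤ a) (hε : ε ∈ Ioo (0 : ℝ) 1) :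
    min 2 a ≤ 2 * a ^ ε := by
  rcases le_total a 1 with h | h
  · have h1 : a ≤ a ^ ε := by
      rcases ha.eq_or_lt with rfl | h0
      · rw [Real.zero_rpow hε.1.ne']
      · conv_lhs => rw [← Real.rpow_one a]
        exact Real.rpow_le_rpow_of_exponent_ge h0 h hε.2.le
    have : min 2 a ≤ a := min_le_right _ _
    linarith
  · have := Real.one_le_rpow h hε.1.le
    have : min 2 a ≤ 2 := min_le_left _ _
    linarith

theorem integrable_norm_sub_rpow {ε : ℝ} (hε : ε ∈ Ioo (0 : ℝ) 1)
    (hmom : ∫⁻ x, ENNReal.ofReal (‖x‖ ^ ε) ∂μX < ⊤) (x : Rd d) :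
    Integrable (fun z => ‖x - z‖ ^ ε) μX := by
  have h0 : Integrable (fun z : Rd d => ‖z‖ ^ ε) μX := by
    refine ⟨(measurable_norm.pow_const ε).aestronglyMeasurable, ?_⟩
    rw [hasFiniteIntegral_iff_ofReal (ae_of_all _ fun u => by positivity)]
    exact hmom
  refine ((integrable_const (‖x‖ ^ ε)).add h0).mono'
    ((by fun_prop : Measurable fun z => ‖x - z‖).pow_const ε).aestronglyMeasurable
    (ae_of_all _ fun z => ?_)
  rw [Real.norm_of_nonneg (by positivity)]
  calc ‖x - z‖ ^ ε ≤ (‖x‖ + ‖z‖) ^ ε :=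
        Real.rpow_le_rpow (norm_nonneg _) (norm_sub_le _ _) hε.1.le
    _ ≤ ‖x‖ ^ ε + ‖z‖ ^ ε :=
        NNReal.rpow_add_le_add_rpow ‖x‖₊ ‖z‖₊ hε.1.le hε.2.le

/-- The law of X is invariant, so E h(X) is the μX-average of P_t h. The increments P_t h(x) - P_t
h(z) are then bounded by both 2 and e^{-t}‖x - z‖. -/
theorem abs_semigroupP_sub_le (hX : ∀ ξ, charFun μX ξ = Complex.exp (ψ ξ))
    (hμ : ∀ t, 0 ≤ t → IsProbabilityMeasure (μ t))
    (hφ : ∀ t, 0 ≤ t → ∀ ξ, charFun (μ t) ξ = Complex.exp (ψ ξ - ψ (Real.exp (-t) • ξ)))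
    {ε : ℝ} (hε : ε ∈ Ioo (0 : ℝ) 1) (hmom : ∫⁻ x, ENNReal.ofReal (‖x‖ ^ ε) ∂μX < ⊤)
    {h : Rd d → ℝ} (hb : ∀ x, |h x| ≤ 1) (hL : ∀ x y, |h x - h y| ≤ ‖x - y‖)
    (hc : Continuous h) {t : ℝ} (ht : 0 ≤ t) (x : Rd d) :
    |semigroupP μ t h x - ∫ z, h z ∂μX| ≤
      (2 * ∫ z, ‖x - z‖ ^ ε ∂μX) * Real.exp (-(ε * t)) := by
  have := hμ t ht
  have hint : ∀ z : Rd d, Integrable (fun y => h (Real.exp (-t) • z + y)) (μ t) := fun z =>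
    Integrable.of_bound (by fun_prop) 1 (ae_of_all _ fun y => hb _)
  have hPint : Integrable (fun z => ∫ y, h (Real.exp (-t) • z + y) ∂(μ t)) μX := by
    refine Integrable.of_bound (StronglyMeasurable.integral_prod_right
      (f := fun z y => h (Real.exp (-t) • z + y)) ?_).aestronglyMeasurable 1
      (ae_of_all _ fun z => ?_)
    · exact (hc.comp (by fun_prop :
        Continuous fun p : Rd d × Rd d => Real.exp (-t) • p.1 + p.2)).stronglyMeasurable
    · simpa using norm_integral_le_of_norm_le_const (μ := μ t) (C := 1)
        (f := fun y => h (Real.exp (-t) • z + y)) (ae_of_all _ fun y => hb _)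
  rw [integral_eq_of_conv (conv_eq_of_exponent hX hμ hφ ht) hc hb, semigroupP]
  have e1 : ∫ y, h (Real.exp (-t) • x + y) ∂(μ t) =
      ∫ _z, (∫ y, h (Real.exp (-t) • x + y) ∂(μ t)) ∂μX := by simp
  have e2 : (2 * ∫ z, ‖x - z‖ ^ ε ∂μX) * Real.exp (-(ε * t)) =
      ∫ z, Real.exp (-(ε * t)) * ‖x - z‖ ^ ε * 2 ∂μX := by
    rw [integral_mul_const, integral_const_mul]
    ring
  rw [e1, e2, ← integral_sub (integrable_const _) hPint, ← Real.norm_eq_abs]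
  refine norm_integral_le_of_norm_le
    (((integrable_norm_sub_rpow hε hmom x).const_mul _).mul_const _) (ae_of_all _ fun z => ?_)
  rw [← integral_sub (hint x) (hint z)]
  have hbd : ∀ y, ‖h (Real.exp (-t) • x + y) - h (Real.exp (-t) • z + y)‖ ≤
      Real.exp (-(ε * t)) * ‖x - z‖ ^ ε * 2 := by
    intro y
    have h1 : |h (Real.exp (-t) • x + y) - h (Real.exp (-t) • z + y)| ≤ 2 := by
      refine (abs_sub _ _).trans ?_
      linarith [hb (Real.exp (-t) • x + y), hb (Real.exp (-t) • z + y)]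
    have h2 : |h (Real.exp (-t) • x + y) - h (Real.exp (-t) • z + y)| ≤
        Real.exp (-t) * ‖x - z‖ := by
      refine (hL _ _).trans_eq ?_
      rw [add_sub_add_right_eq_sub, ← smul_sub, norm_smul, Real.norm_of_nonneg (Real.exp_pos _).le]
    refine (le_min h1 h2).trans ((min_two_le_rpow (by positivity) hε).trans_eq ?_)
    rw [Real.mul_rpow (Real.exp_pos _).le (norm_nonneg _), ← Real.exp_mul]
    have : -t * ε = -(ε * t) := by ring
    rw [this]
    ring
  simpa using norm_integral_le_of_norm_le_const (μ := μ t) (ae_of_all _ hbd)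

end

end

section

/-! ### Smoothness of the semigroup and of its time integral -/

theorem integrable_flowOp {d : ℕ} {F : Type*} [NormedAddCommGroup F]
    (κ : ProbabilityTheory.Kernel ℝ (Rd d)) [ProbabilityTheory.IsMarkovKernel κ]
    {g : Rd d → F} (hg : Continuous g) {B : ℝ} (hB : ∀ x, ‖g x‖ ≤ B)
    (t : ℝ) (x : Rd d) : Integrable (fun y => g (Real.exp (-t) • x + y)) (κ t) :=
  Integrable.of_bound (hg.comp (by fun_prop)).aestronglyMeasurable B (ae_of_all _ fun y => hB _)

variable {d : ℕ} {F : Type*} [NormedAddCommGroup F] [NormedSpace ℝ F]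
  (κ : ProbabilityTheory.Kernel ℝ (Rd d)) [hκ : ProbabilityTheory.IsMarkovKernel κ]

/-- `∫ g(e^{-t} x + y) κ_t(dy)`, for functions `g` with values in a normed space. -/
def flowOp (κ : ProbabilityTheory.Kernel ℝ (Rd d)) (g : Rd d → F) (t : ℝ) (x : Rd d) : F :=
  ∫ y, g (Real.exp (-t) • x + y) ∂(κ t)

theorem stronglyMeasurable_flowOp {g : Rd d → F} (hg : Continuous g) :
    StronglyMeasurable fun p : ℝ × Rd d => flowOp κ g p.1 p.2 := by
  have h : StronglyMeasurable (Function.uncurry fun (p : ℝ × Rd d) (y : Rd d) =>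
      g (Real.exp (-p.1) • p.2 + y)) :=
    (hg.comp (by fun_prop : Continuous fun q : (ℝ × Rd d) × Rd d =>
      Real.exp (-q.1.1) • q.1.2 + q.2)).stronglyMeasurable
  exact h.integral_kernel_prod_right (κ := κ.comap Prod.fst measurable_fst)

theorem stronglyMeasurable_flowOp_left {g : Rd d → F} (hg : Continuous g) (x : Rd d) :
    StronglyMeasurable fun t : ℝ => flowOp κ g t x :=
  (stronglyMeasurable_flowOp κ hg).comp_measurable
    (by fun_prop : Measurable fun t : ℝ => (t, x))

theorem norm_flowOp_le {g : Rd d → F} {B : ℝ} (hB : ∀ x, ‖g x‖ ≤ B) (t : ℝ) (x : Rd d) :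
    ‖flowOp κ g t x‖ ≤ B := by
  simpa [flowOp] using norm_integral_le_of_norm_le_const (μ := κ t)
    (ae_of_all _ fun y => hB (Real.exp (-t) • x + y))

theorem continuous_flowOp {g : Rd d → F} (hg : Continuous g) {B : ℝ} (hB : ∀ x, ‖g x‖ ≤ B)
    (t : ℝ) : Continuous (flowOp κ g t) :=
  continuous_of_dominated (fun x => (integrable_flowOp κ hg hB t x).aestronglyMeasurable)
    (fun x => ae_of_all _ fun y => hB _) (integrable_const B)
    (ae_of_all _ fun y => hg.comp (by fun_prop))

theorem hasFDerivAt_flowOp {g : Rd d → F} {g' : Rd d → Rd d →L[ℝ] F}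
    (hg : ∀ x, HasFDerivAt g (g' x) x) (hg' : Continuous g') {A B : ℝ} (hA : ∀ x, ‖g x‖ ≤ A)
    (hB : ∀ x, ‖g' x‖ ≤ B) (t : ℝ) (x : Rd d) :
    HasFDerivAt (flowOp κ g t) (Real.exp (-t) • flowOp κ g' t x) x := by
  have hgc : Continuous g := continuous_iff_continuousAt.2 fun x => (hg x).continuousAt
  rw [flowOp, ← integral_smul]
  have hm : Continuous fun y => Real.exp (-t) • g' (Real.exp (-t) • x + y) := by
    fun_prop
  refine hasFDerivAt_integral_of_dominated_of_fderiv_le (s := univ)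
    (bound := fun _ => Real.exp (-t) * B)
    (F' := fun x y => Real.exp (-t) • g' (Real.exp (-t) • x + y)) univ_mem
    (Eventually.of_forall fun x => (integrable_flowOp κ hgc hA t x).aestronglyMeasurable)
    (integrable_flowOp κ hgc hA t x)
    hm.aestronglyMeasurable
    (ae_of_all _ fun y z _ => ?_) (integrable_const _) (ae_of_all _ fun y z _ => ?_)
  · rw [norm_smul, Real.norm_of_nonneg (Real.exp_pos _).le]
    exact mul_le_mul_of_nonneg_left (hB _) (Real.exp_pos _).le
  · have h1 : HasFDerivAt (fun x : Rd d => Real.exp (-t) • x + y)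
        (Real.exp (-t) • ContinuousLinearMap.id ℝ (Rd d)) z :=
      ((hasFDerivAt_id z).fun_const_smul (Real.exp (-t))).add_const y
    have h2 := (hg (Real.exp (-t) • z + y)).comp z h1
    rw [ContinuousLinearMap.comp_smul, ContinuousLinearMap.comp_id] at h2
    exact h2

theorem integrableOn_exp_neg_nat_mul {n : ℕ} (hn : 1 ≤ n) :
    IntegrableOn (fun t : ℝ => Real.exp (-(n * t))) (Ioi 0) := by
  have := exp_neg_integrableOn_Ioi 0 (b := (n : ℝ)) (by positivity)
  simpa only [neg_mul] using this

theorem integral_exp_neg_nat_mul {n : ℕ} (hn : 1 ≤ n) :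
    ∫ t in Ioi (0 : ℝ), Real.exp (-(n * t)) = 1 / n := by
  have h := integral_comp_mul_left_Ioi (fun t => Real.exp (-t)) 0
    (b := (n : ℝ)) (by positivity)
  rw [mul_zero, integral_exp_neg_Ioi_zero] at h
  rw [h]
  simp

theorem integrableOn_exp_smul_flowOp {n : ℕ} (hn : 1 ≤ n) {g : Rd d → F} (hg : Continuous g)
    {B : ℝ} (hB : ∀ x, ‖g x‖ ≤ B) (x : Rd d) :
    IntegrableOn (fun t => Real.exp (-(n * t)) • flowOp κ g t x) (Ioi 0) := by
  refine ((integrableOn_exp_neg_nat_mul hn).mul_const B).mono'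
    ((by fun_prop : Measurable fun t : ℝ => Real.exp (-(n * t))).stronglyMeasurable.smul
      (stronglyMeasurable_flowOp_left κ hg x)).aestronglyMeasurable (ae_of_all _ fun t => ?_)
  rw [norm_smul, Real.norm_of_nonneg (Real.exp_pos _).le]
  exact mul_le_mul_of_nonneg_left (norm_flowOp_le κ hB t x) (Real.exp_pos _).le

theorem norm_integral_exp_smul_flowOp_le {n : ℕ} (hn : 1 ≤ n) {g : Rd d → F}
    {B : ℝ} (hB : ∀ x, ‖g x‖ ≤ B) (x : Rd d) :
    ‖∫ t in Ioi (0 : ℝ), Real.exp (-(n * t)) • flowOp κ g t x‖ ≤ 1 / n * B := by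
  rw [← integral_exp_neg_nat_mul hn, ← integral_mul_const]
  refine norm_integral_le_of_norm_le ((integrableOn_exp_neg_nat_mul hn).mul_const B)
    (ae_of_all _ fun t => ?_)
  rw [norm_smul, Real.norm_of_nonneg (Real.exp_pos _).le]
  exact mul_le_mul_of_nonneg_left (norm_flowOp_le κ hB t x) (Real.exp_pos _).le

theorem continuous_integral_exp_smul_flowOp {n : ℕ} (hn : 1 ≤ n) {g : Rd d → F}
    (hg : Continuous g) {B : ℝ} (hB : ∀ x, ‖g x‖ ≤ B) :
    Continuous fun x => ∫ t in Ioi (0 : ℝ), Real.exp (-(n * t)) • flowOp κ g t x := by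
  refine continuous_of_dominated
    (fun x => (integrableOn_exp_smul_flowOp κ hn hg hB x).aestronglyMeasurable)
    (fun x => ae_of_all _ fun t => ?_) ((integrableOn_exp_neg_nat_mul hn).mul_const B)
    (ae_of_all _ fun t => (continuous_flowOp κ hg hB t).const_smul _)
  rw [norm_smul, Real.norm_of_nonneg (Real.exp_pos _).le]
  exact mul_le_mul_of_nonneg_left (norm_flowOp_le κ hB t x) (Real.exp_pos _).le

/-- Differentiating `flowOp` brings out e^{-t}, which raises the weight from n to n + 1. The case n
= 0, c = E h(X) gives the gradient of the solution; n = 1, c = 0 gives its Hessian. The constant c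
only secures integrability at infinity. -/
theorem hasFDerivAt_integral_exp_smul_flowOp (n : ℕ) {g : Rd d → F}
    {g' : Rd d → Rd d →L[ℝ] F} (hg : ∀ x, HasFDerivAt g (g' x) x) (hg' : Continuous g')
    {A B : ℝ} (hA : ∀ x, ‖g x‖ ≤ A) (hB : ∀ x, ‖g' x‖ ≤ B) (c : F)
    (hi : ∀ x, IntegrableOn (fun t => Real.exp (-(n * t)) • (flowOp κ g t x - c)) (Ioi 0))
    (x : Rd d) :
    HasFDerivAt (fun x => ∫ t in Ioi (0 : ℝ), Real.exp (-(n * t)) • (flowOp κ g t x - c))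
      (∫ t in Ioi (0 : ℝ), Real.exp (-((n + 1 : ℕ) * t)) • flowOp κ g' t x) x := by
  have he : ∀ t : ℝ, Real.exp (-((n + 1 : ℕ) * t)) = Real.exp (-(n * t)) * Real.exp (-t) := by
    intro t
    rw [← Real.exp_add]
    congr 1
    push_cast
    ring
  refine hasFDerivAt_integral_of_dominated_of_fderiv_le (s := univ)
    (bound := fun t => Real.exp (-((n + 1 : ℕ) * t)) * B)
    (F' := fun x t => Real.exp (-((n + 1 : ℕ) * t)) • flowOp κ g' t x) univ_mem
    (Eventually.of_forall fun x => (hi x).aestronglyMeasurable) (hi x)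
    (integrableOn_exp_smul_flowOp κ (by omega) hg' hB x).aestronglyMeasurable
    (ae_of_all _ fun t z _ => ?_)
    ((integrableOn_exp_neg_nat_mul (by omega)).mul_const B) (ae_of_all _ fun t z _ => ?_)
  · rw [norm_smul, Real.norm_of_nonneg (Real.exp_pos _).le]
    exact mul_le_mul_of_nonneg_left (norm_flowOp_le κ hB t z) (Real.exp_pos _).le
  · rw [he, mul_smul]
    exact ((hasFDerivAt_flowOp κ hg hg' hA hB t z).sub_const c).fun_const_smul _

end

section

/-! ### The generator on Fourier modes -/

section FourierModes

variable {d : ℕ}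

/-- A smooth compactly supported function is Schwartz, and so is its Fourier transform. The moments
of order 0, 1 and 2 of `H` later dominate the modes, their gradients and their jump integrals. -/
theorem exists_fourier_representation {h : Rd d → ℝ} (hs : ContDiff ℝ (⊤ : ℕ∞) h)
    (hc : HasCompactSupport h) :
    ∃ H : Rd d → ℂ, Continuous H ∧ (∀ n : ℕ, Integrable fun w => ‖w‖ ^ n * ‖H w‖) ∧
      ∀ x, (h x : ℂ) =
        ∫ w, H w * Complex.exp (Complex.I * (inner ℝ ((2 * Real.pi) • w) x : ℝ)) := by
  have h1 : HasCompactSupport fun x => (h x : ℂ) := hc.comp_left (g := fun r : ℝ => (r : ℂ)) rfl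
  have h2 : ContDiff ℝ (⊤ : ℕ∞) fun x => (h x : ℂ) := Complex.ofRealCLM.contDiff.comp hs
  let f : SchwartzMap (Rd d) ℂ := h1.toSchwartzMap h2
  refine ⟨FourierTransform.fourier f, SchwartzMap.continuous _,
    fun n => SchwartzMap.integrable_pow_mul _ _ n, fun x => ?_⟩
  have e : FourierTransformInv.fourierInv (FourierTransform.fourier f) x = f x := by
    rw [FourierTransform.fourierInv_fourier_eq]
  rw [SchwartzMap.fourierInv_coe, Real.fourierInv_eq'] at e
  change f x = _
  rw [← e]
  refine integral_congr_ae (ae_of_all _ fun w => ?_)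
  simp only [real_inner_smul_left, smul_eq_mul]
  rw [mul_comm, mul_comm Complex.I]

/-- The image of the mode `e^{i⟨ξ,·⟩}` under the semigroup whose laws have characteristic function
`exp(ψ(ξ) - ψ(e^{-t} ξ))`. -/
def flowMode (ψ : Rd d → ℂ) (ξ : Rd d) (t : ℝ) (x : Rd d) : ℂ :=
  Complex.exp (Complex.I * (Real.exp (-t) * inner ℝ ξ x : ℝ)) *
    Complex.exp (ψ ξ - ψ (Real.exp (-t) • ξ))

variable {ψ : Rd d → ℂ}

theorem continuous_flowMode_left (hψ : Continuous ψ) (t : ℝ) (x : Rd d) :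
    Continuous fun ξ => flowMode ψ ξ t x := by
  unfold flowMode; fun_prop

theorem continuous_flowMode_time (hψ : Continuous ψ) (ξ x : Rd d) :
    Continuous fun t => flowMode ψ ξ t x := by
  unfold flowMode; fun_prop

theorem flowMode_add (ξ : Rd d) (t : ℝ) (x u : Rd d) :
    flowMode ψ ξ t (x + u) =
      flowMode ψ ξ t x * Complex.exp (Complex.I * (inner ℝ (Real.exp (-t) • ξ) u : ℝ)) := by
  have : Complex.exp (Complex.I * (Real.exp (-t) * inner ℝ ξ (x + u) : ℝ)) =
      Complex.exp (Complex.I * (Real.exp (-t) * inner ℝ ξ x : ℝ)) *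
        Complex.exp (Complex.I * (inner ℝ (Real.exp (-t) • ξ) u : ℝ)) := by
    rw [← Complex.exp_add, inner_add_right, real_inner_smul_left]
    congr 1
    push_cast
    ring
  unfold flowMode
  rw [this, mul_right_comm]

/-- A compensated jump acts on an exponential mode as multiplication by the Lévy kernel. -/
theorem flowMode_mul_levyKernel (ξ : Rd d) (t : ℝ) (x u : Rd d) :
    flowMode ψ ξ t x * levyKernel (Real.exp (-t) • ξ) u =
      flowMode ψ ξ t (x + u) - flowMode ψ ξ t x -
        if ‖u‖ ≤ 1 then
          flowMode ψ ξ t x * (Complex.I * (inner ℝ (Real.exp (-t) • ξ) u : ℝ)) else 0 := by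
  rw [levyKernel, flowMode_add]
  split_ifs <;> ring

/-- The Kolmogorov equation on one mode: the phase contributes the drift -x, and -ψ(e^{-t}ξ)
contributes the drift b together with the jump term. -/
theorem hasDerivAt_flowMode {b : Rd d} {ν : Measure (Rd d)} {ξ : Rd d} {t : ℝ}
    (hψ : HasDerivAt (fun t => ψ (Real.exp (-t) • ξ))
      (-levyExponent b ν (Real.exp (-t) • ξ)) t) (x : Rd d) :
    HasDerivAt (fun t => flowMode ψ ξ t x)
      (flowMode ψ ξ t x * (Complex.I * (inner ℝ (Real.exp (-t) • ξ) (b - x) : ℝ) +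
        ∫ u, levyKernel (Real.exp (-t) • ξ) u ∂ν)) t := by
  have h1 : HasDerivAt (fun t : ℝ => Real.exp (-t) * inner ℝ ξ x)
      (-(Real.exp (-t) * inner ℝ ξ x)) t := by
    have := ((hasDerivAt_neg t).exp).mul_const (inner ℝ ξ x)
    convert! this using 1
    ring
  have h2 : HasDerivAt (fun t : ℝ => Complex.exp
      (Complex.I * (Real.exp (-t) * inner ℝ ξ x : ℝ))) _ t :=
    ((h1.ofReal_comp).const_mul Complex.I).cexp
  have h3 : HasDerivAt (fun t : ℝ => Complex.exp (ψ ξ - ψ (Real.exp (-t) • ξ))) _ t :=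
    (hψ.const_sub (ψ ξ)).cexp
  refine (h2.mul h3).congr_deriv ?_
  unfold flowMode levyExponent
  rw [inner_sub_right, real_inner_smul_left, real_inner_smul_left, real_inner_smul_right,
    real_inner_comm b ξ]
  push_cast
  ring

/-! ### The Kolmogorov equation by superposition of Fourier modes. -/

section

theorem integral_exp_flow (κ : ProbabilityTheory.Kernel ℝ (Rd d)) {t : ℝ}
    (hφ : ∀ ξ, charFun (κ t) ξ = Complex.exp (ψ ξ - ψ (Real.exp (-t) • ξ))) (ξ x : Rd d) :
    ∫ y, Complex.exp (Complex.I * (inner ℝ ξ (Real.exp (-t) • x + y) : ℝ)) ∂(κ t) =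
      flowMode ψ ξ t x := by
  rw [flowMode, ← hφ, charFun_apply, ← integral_const_mul]
  refine integral_congr_ae (ae_of_all _ fun y => ?_)
  simp only
  rw [← Complex.exp_add, inner_add_right, real_inner_smul_right, real_inner_comm y ξ]
  congr 1
  push_cast
  ring

variable (κ : ProbabilityTheory.Kernel ℝ (Rd d)) [hκ : ProbabilityTheory.IsMarkovKernel κ]

theorem norm_flowMode_le_one {t : ℝ}
    (hφ : ∀ ξ, charFun (κ t) ξ = Complex.exp (ψ ξ - ψ (Real.exp (-t) • ξ))) (ξ x : Rd d) :
    ‖flowMode ψ ξ t x‖ ≤ 1 := by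
  rw [flowMode, ← hφ, norm_mul, Complex.norm_exp_I_mul_ofReal, one_mul]
  exact norm_charFun_le_one ξ

variable {h : Rd d → ℝ}

theorem integrable_of_integrable_pow {H : Rd d → ℂ} (hH : Continuous H)
    (hHi : ∀ n : ℕ, Integrable fun w => ‖w‖ ^ n * ‖H w‖) : Integrable H :=
  (hHi 0).mono' hH.aestronglyMeasurable (ae_of_all _ fun w => by simp)

theorem flowOp_eq_integral_flowMode {H : Rd d → ℂ} (hH : Continuous H)
    (hHi : ∀ n : ℕ, Integrable fun w => ‖w‖ ^ n * ‖H w‖) {t : ℝ}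
    (hφ : ∀ ξ, charFun (κ t) ξ = Complex.exp (ψ ξ - ψ (Real.exp (-t) • ξ)))
    (hrep : ∀ x, (h x : ℂ) =
      ∫ w, H w * Complex.exp (Complex.I * (inner ℝ ((2 * Real.pi) • w) x : ℝ))) (x : Rd d) :
    ((flowOp κ h t x : ℝ) : ℂ) = ∫ w, H w * flowMode ψ ((2 * Real.pi) • w) t x := by
  rw [flowOp, ← integral_complex_ofReal]
  simp only [hrep]
  rw [integral_integral_swap]
  · simp only [integral_const_mul, integral_exp_flow κ hφ]
  · refine ((integrable_const (1 : ℝ)).mul_prod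
      (integrable_of_integrable_pow hH hHi).norm).mono' ?_ (ae_of_all _ fun p => ?_)
    · refine Continuous.aestronglyMeasurable ?_
      unfold Function.uncurry
      fun_prop
    · simp only [Function.uncurry, norm_mul, Complex.norm_exp_I_mul_ofReal, mul_one, one_mul, le_refl]

theorem integrable_mul_flowMode {H : Rd d → ℂ} (hH : Continuous H)
    (hHi : ∀ n : ℕ, Integrable fun w => ‖w‖ ^ n * ‖H w‖) (hψ : Continuous ψ) {t : ℝ}
    (hφ : ∀ ξ, charFun (κ t) ξ = Complex.exp (ψ ξ - ψ (Real.exp (-t) • ξ))) (x : Rd d) :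
    Integrable fun w => H w * flowMode ψ ((2 * Real.pi) • w) t x := by
  refine (integrable_of_integrable_pow hH hHi).norm.mono' ?_ (ae_of_all _ fun w => ?_)
  · exact (hH.mul ((continuous_flowMode_left hψ t x).comp (by fun_prop))).aestronglyMeasurable
  · rw [norm_mul]
    exact mul_le_of_le_one_right (norm_nonneg _) (norm_flowMode_le_one κ hφ _ x)

theorem norm_smul_two_pi (w : Rd d) : ‖(2 * Real.pi) • w‖ = 2 * Real.pi * ‖w‖ := by
  rw [norm_smul, Real.norm_of_nonneg (by positivity)]

theorem norm_flow_le {t : ℝ} (ht : 0 ≤ t) (ξ : Rd d) : ‖Real.exp (-t) • ξ‖ ≤ ‖ξ‖ := by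
  rw [norm_smul, Real.norm_of_nonneg (Real.exp_pos _).le]
  exact mul_le_of_le_one_left (norm_nonneg _) (Real.exp_le_one_iff.2 (by linarith))

/-- The derivative of the semigroup in space, in terms of Fourier modes. -/
theorem fderiv_flowOp_eq_integral {H : Rd d → ℂ} (hH : Continuous H)
    (hHi : ∀ n : ℕ, Integrable fun w => ‖w‖ ^ n * ‖H w‖) (hψ : Continuous ψ) {t : ℝ}
    (ht : 0 ≤ t)
    (hφ : ∀ ξ, charFun (κ t) ξ = Complex.exp (ψ ξ - ψ (Real.exp (-t) • ξ)))
    (hrep : ∀ x, (h x : ℂ) =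
      ∫ w, H w * Complex.exp (Complex.I * (inner ℝ ((2 * Real.pi) • w) x : ℝ)))
    {x : Rd d} {L : Rd d →L[ℝ] ℝ} (hL : HasFDerivAt (flowOp κ h t) L x) (v : Rd d) :
    Integrable (fun w => H w * (flowMode ψ ((2 * Real.pi) • w) t x *
      (Complex.I * (inner ℝ (Real.exp (-t) • (2 * Real.pi) • w) v : ℝ)))) ∧
    (L v : ℂ) = ∫ w, H w * (flowMode ψ ((2 * Real.pi) • w) t x *
      (Complex.I * (inner ℝ (Real.exp (-t) • (2 * Real.pi) • w) v : ℝ))) := by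
  have hline : HasDerivAt (fun s : ℝ => x + s • v) v 0 := by
    simpa using ((hasDerivAt_id (0 : ℝ)).smul_const v).const_add x
  have h1 : HasDerivAt (fun s : ℝ => flowOp κ h t (x + s • v)) (L v) 0 := by
    have hL' : HasFDerivAt (flowOp κ h t) L (x + (0 : ℝ) • v) := by simpa using hL
    exact hL'.comp_hasDerivAt (0 : ℝ) hline
  have h2 : HasDerivAt (fun s : ℝ => ((flowOp κ h t (x + s • v) : ℝ) : ℂ)) (L v : ℂ) 0 := h1.ofReal_comp
  simp only [flowOp_eq_integral_flowMode κ hH hHi hφ hrep] at h2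
  have hmode : ∀ (ξ : Rd d) (s : ℝ), HasDerivAt (fun s : ℝ => flowMode ψ ξ t (x + s • v))
      (flowMode ψ ξ t (x + s • v) * (Complex.I * (inner ℝ (Real.exp (-t) • ξ) v : ℝ))) s := by
    intro ξ s
    have e : ∀ s : ℝ, flowMode ψ ξ t (x + s • v) = flowMode ψ ξ t x *
        Complex.exp (Complex.I * (s * inner ℝ (Real.exp (-t) • ξ) v : ℝ)) := by
      intro s
      rw [flowMode_add, real_inner_smul_right]
    have hd : HasDerivAt (fun s : ℝ => s * inner ℝ (Real.exp (-t) • ξ) v)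
        (inner ℝ (Real.exp (-t) • ξ) v) s := by
      simpa using (hasDerivAt_id s).mul_const (inner ℝ (Real.exp (-t) • ξ) v)
    simp only [e]
    refine ((((hd.ofReal_comp).const_mul Complex.I).cexp).const_mul _).congr_deriv ?_
    ring
  -- The Fourier integral is differentiated along the line x + s v. Uniqueness of the derivative at
  -- s = 0 then identifies `L v`.
  have h3 := hasDerivAt_integral_of_dominated_loc_of_deriv_le (𝕜 := ℝ) (μ := volume)
    (F := fun (s : ℝ) w => H w * flowMode ψ ((2 * Real.pi) • w) t (x + s • v))
    (F' := fun (s : ℝ) w => H w * (flowMode ψ ((2 * Real.pi) • w) t (x + s • v) *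
      (Complex.I * (inner ℝ (Real.exp (-t) • (2 * Real.pi) • w) v : ℝ))))
    (x₀ := 0) (s := univ) (bound := fun w => 2 * Real.pi * ‖v‖ * (‖w‖ ^ 1 * ‖H w‖)) univ_mem
    (Eventually.of_forall fun s =>
      (integrable_mul_flowMode κ hH hHi hψ hφ (x + s • v)).aestronglyMeasurable)
    (integrable_mul_flowMode κ hH hHi hψ hφ _) ?_ (ae_of_all _ fun w s _ => ?_)
    ((hHi 1).const_mul _) (ae_of_all _ fun w s _ => (hmode _ s).const_mul _)
  · have := h2.unique h3.2
    simp only [zero_smul, add_zero] at this h3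
    exact ⟨h3.1, this⟩
  · refine (hH.mul (((continuous_flowMode_left hψ t _).comp (by fun_prop)).mul
      (by fun_prop))).aestronglyMeasurable
  · rw [norm_mul, norm_mul, norm_mul, Complex.norm_I, one_mul, Complex.norm_real]
    have e1 := norm_flowMode_le_one κ hφ ((2 * Real.pi) • w) (x + s • v)
    have e2 : ‖(inner ℝ (Real.exp (-t) • (2 * Real.pi) • w) v : ℝ)‖ ≤
        2 * Real.pi * ‖w‖ * ‖v‖ := by
      refine (abs_real_inner_le_norm _ _).trans ?_
      gcongr
      exact (norm_flow_le ht _).trans_eq (norm_smul_two_pi w)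
    calc _ ≤ ‖H w‖ * (1 * (2 * Real.pi * ‖w‖ * ‖v‖)) := by gcongr
      _ = _ := by ring

/-- The compensated jump integral of the semigroup, in terms of Fourier modes. -/
theorem integral_jump_flowOp_eq {H : Rd d → ℂ} (hH : Continuous H)
    (hHi : ∀ n : ℕ, Integrable fun w => ‖w‖ ^ n * ‖H w‖) (hψ : Continuous ψ) {t : ℝ}
    (ht : 0 ≤ t)
    (hφ : ∀ ξ, charFun (κ t) ξ = Complex.exp (ψ ξ - ψ (Real.exp (-t) • ξ)))
    (hrep : ∀ x, (h x : ℂ) =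
      ∫ w, H w * Complex.exp (Complex.I * (inner ℝ ((2 * Real.pi) • w) x : ℝ)))
    {ν : Measure (Rd d)} [SFinite ν] (hν : Integrable (fun u => min 1 (‖u‖ ^ 2)) ν)
    {x : Rd d} {L : Rd d →L[ℝ] ℝ} (hL : HasFDerivAt (flowOp κ h t) L x) :
    Integrable (fun w => H w * (flowMode ψ ((2 * Real.pi) • w) t x *
      ∫ u, levyKernel (Real.exp (-t) • (2 * Real.pi) • w) u ∂ν)) ∧
    ((∫ u, (flowOp κ h t (x + u) - flowOp κ h t x - if ‖u‖ ≤ 1 then L u else 0) ∂ν : ℝ) : ℂ) =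
      ∫ w, H w * (flowMode ψ ((2 * Real.pi) • w) t x *
        ∫ u, levyKernel (Real.exp (-t) • (2 * Real.pi) • w) u ∂ν) := by
  have hpt : ∀ u, ((flowOp κ h t (x + u) - flowOp κ h t x - if ‖u‖ ≤ 1 then L u else 0 : ℝ) : ℂ) =
      ∫ w, H w * (flowMode ψ ((2 * Real.pi) • w) t x *
        levyKernel (Real.exp (-t) • (2 * Real.pi) • w) u) := by
    intro u
    obtain ⟨hi, hLu⟩ := fderiv_flowOp_eq_integral κ hH hHi hψ ht hφ hrep hL u
    have i1 := integrable_mul_flowMode κ hH hHi hψ hφ (x + u)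
    have i2 := integrable_mul_flowMode κ hH hHi hψ hφ x
    simp only [flowMode_mul_levyKernel]
    push_cast
    rw [flowOp_eq_integral_flowMode κ hH hHi hφ hrep, flowOp_eq_integral_flowMode κ hH hHi hφ hrep,
      ← integral_sub i1 i2]
    by_cases hu : ‖u‖ ≤ 1
    · simp only [hu, if_true]
      have i12 : Integrable fun w => H w * flowMode ψ ((2 * Real.pi) • w) t (x + u) -
          H w * flowMode ψ ((2 * Real.pi) • w) t x := i1.sub i2
      rw [hLu, ← integral_sub i12 hi]
      refine integral_congr_ae (ae_of_all _ fun w => ?_)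
      simp only
      ring
    · simp only [hu, if_false, Complex.ofReal_zero, sub_zero, mul_sub]
  have hmeas : Measurable fun p : Rd d × Rd d =>
      levyKernel (Real.exp (-t) • (2 * Real.pi) • p.2) p.1 :=
    measurable_levyKernel.comp (g := fun p : Rd d × Rd d => levyKernel p.1 p.2)
      (f := fun p : Rd d × Rd d => (Real.exp (-t) • (2 * Real.pi) • p.2, p.1)) (by fun_prop)
  -- The Lévy kernel at frequency 2πw is at most ((2π‖w‖)² + 2) min(1, ‖u‖²), a sum of products in u
  -- and w that allows Fubini.
  have hprod : Integrable (Function.uncurry fun u w => H w * (flowMode ψ ((2 * Real.pi) • w) t x *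
      levyKernel (Real.exp (-t) • (2 * Real.pi) • w) u)) (ν.prod volume) := by
    refine (hν.mul_prod (((hHi 2).const_mul ((2 * Real.pi) ^ 2)).add
      ((hHi 0).const_mul 2))).mono' ?_ (ae_of_all _ fun p => ?_)
    · refine (Measurable.mul (hH.measurable.comp measurable_snd)
        (Measurable.mul ?_ hmeas)).aestronglyMeasurable
      exact (continuous_flowMode_left hψ t x).measurable.comp
        (by fun_prop : Measurable fun p : Rd d × Rd d => (2 * Real.pi) • p.2)
    · simp only [Function.uncurry, norm_mul, Pi.add_apply]
      have e1 := norm_flowMode_le_one κ hφ ((2 * Real.pi) • p.2) x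
      have e2 := norm_levyKernel_le (Real.exp (-t) • (2 * Real.pi) • p.2) p.1
      have e3 : ‖Real.exp (-t) • (2 * Real.pi) • p.2‖ ≤ 2 * Real.pi * ‖p.2‖ :=
        (norm_flow_le ht _).trans_eq (norm_smul_two_pi p.2)
      calc _ ≤ ‖H p.2‖ * (1 * (((2 * Real.pi * ‖p.2‖) ^ 2 + 2) * min 1 (‖p.1‖ ^ 2))) := by
            gcongr
            exact e2.trans (by gcongr)
        _ = _ := by ring
  have hswap := integral_integral_swap hprod
  have hint := hprod.integral_prod_right
  simp only [Function.uncurry, integral_const_mul] at hint hswap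
  refine ⟨hint, ?_⟩
  rw [← integral_complex_ofReal]
  simp only [hpt]
  exact hswap

/-- The Kolmogorov equation of the semigroup. -/
theorem hasDerivAt_flowOp_time {H : Rd d → ℂ} (hH : Continuous H)
    (hHi : ∀ n : ℕ, Integrable fun w => ‖w‖ ^ n * ‖H w‖) (hψ : Continuous ψ)
    (hφ : ∀ t, 0 ≤ t → ∀ ξ, charFun (κ t) ξ = Complex.exp (ψ ξ - ψ (Real.exp (-t) • ξ)))
    (hrep : ∀ x, (h x : ℂ) =
      ∫ w, H w * Complex.exp (Complex.I * (inner ℝ ((2 * Real.pi) • w) x : ℝ)))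
    {b : Rd d} {ν : Measure (Rd d)} [SFinite ν] (hν : Integrable (fun u => min 1 (‖u‖ ^ 2)) ν)
    (hψd : ∀ ξ t, HasDerivAt (fun t => ψ (Real.exp (-t) • ξ))
      (-levyExponent b ν (Real.exp (-t) • ξ)) t)
    {t : ℝ} (ht : 0 < t) {x : Rd d} {L : Rd d →L[ℝ] ℝ} (hL : HasFDerivAt (flowOp κ h t) L x) :
    HasDerivAt (fun t => flowOp κ h t x) (L (b - x) +
      ∫ u, (flowOp κ h t (x + u) - flowOp κ h t x - if ‖u‖ ≤ 1 then L u else 0) ∂ν) t := by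
  obtain ⟨i1, e1⟩ := fderiv_flowOp_eq_integral κ hH hHi hψ ht.le (hφ t ht.le) hrep hL (b - x)
  obtain ⟨i2, e2⟩ := integral_jump_flowOp_eq κ hH hHi hψ ht.le (hφ t ht.le) hrep hν hL
  set C := ∫ u, min 1 (‖u‖ ^ 2) ∂ν with hC
  have hC0 : 0 ≤ C := integral_nonneg fun u => by positivity
  -- The neighbourhood is (0, ∞): there the characteristic function formula holds, bounding the
  -- modes by 1, and ‖e^{-s}ξ‖ ≤ ‖ξ‖ makes the bound uniform in s.
  have hder := hasDerivAt_integral_of_dominated_loc_of_deriv_le (𝕜 := ℝ) (μ := volume)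
    (F := fun (t : ℝ) w => H w * flowMode ψ ((2 * Real.pi) • w) t x)
    (F' := fun (t : ℝ) w => H w * (flowMode ψ ((2 * Real.pi) • w) t x *
      (Complex.I * (inner ℝ (Real.exp (-t) • (2 * Real.pi) • w) (b - x) : ℝ) +
        ∫ u, levyKernel (Real.exp (-t) • (2 * Real.pi) • w) u ∂ν)))
    (x₀ := t) (s := Ioi 0)
    (bound := fun w => 2 * Real.pi * ‖b - x‖ * (‖w‖ ^ 1 * ‖H w‖) +
      (C * (2 * Real.pi) ^ 2 * (‖w‖ ^ 2 * ‖H w‖) + C * 2 * (‖w‖ ^ 0 * ‖H w‖)))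
    (Ioi_mem_nhds ht)
    ?_ (integrable_mul_flowMode κ hH hHi hψ (hφ t ht.le) x) ?_ (ae_of_all _ fun w s hs => ?_)
    (((hHi 1).const_mul _).add (((hHi 2).const_mul _).add ((hHi 0).const_mul _)))
    (ae_of_all _ fun w s hs => (hasDerivAt_flowMode (hψd _ s) x).const_mul _)
  · have hre := hder.2.congr_of_eventuallyEq (f₁ := fun t => ((flowOp κ h t x : ℝ) : ℂ)) (by
      filter_upwards [Ioi_mem_nhds ht] with s hs
      exact flowOp_eq_integral_flowMode κ hH hHi (hφ s (le_of_lt hs)) hrep x)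
    have hsum : ∫ w, H w * (flowMode ψ ((2 * Real.pi) • w) t x *
        (Complex.I * (inner ℝ (Real.exp (-t) • (2 * Real.pi) • w) (b - x) : ℝ) +
          ∫ u, levyKernel (Real.exp (-t) • (2 * Real.pi) • w) u ∂ν)) =
        ((L (b - x) + ∫ u, (flowOp κ h t (x + u) - flowOp κ h t x -
          if ‖u‖ ≤ 1 then L u else 0) ∂ν : ℝ) : ℂ) := by
      rw [Complex.ofReal_add, e1, e2, ← integral_add i1 i2]
      refine integral_congr_ae (ae_of_all _ fun w => ?_)
      simp only
      ring
    rw [hsum] at hre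
    have := Complex.reCLM.hasFDerivAt.comp_hasDerivAt t hre
    simpa [Function.comp_def] using this
  · filter_upwards [Ioi_mem_nhds ht] with s hs
    exact (integrable_mul_flowMode κ hH hHi hψ (hφ s (le_of_lt hs)) x).aestronglyMeasurable
  · refine (i1.add i2).aestronglyMeasurable.congr (ae_of_all _ fun w => ?_)
    simp only [Pi.add_apply]
    ring
  · have hs0 : 0 ≤ s := le_of_lt hs
    have b1 := norm_flowMode_le_one κ (hφ s hs0) ((2 * Real.pi) • w) x
    have e3 : ‖Real.exp (-s) • (2 * Real.pi) • w‖ ≤ 2 * Real.pi * ‖w‖ :=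
      (norm_flow_le hs0 _).trans_eq (norm_smul_two_pi w)
    have b2 : ‖Complex.I * ((inner ℝ (Real.exp (-s) • (2 * Real.pi) • w) (b - x) : ℝ) : ℂ)‖ ≤
        2 * Real.pi * ‖w‖ * ‖b - x‖ := by
      rw [norm_mul, Complex.norm_I, one_mul, Complex.norm_real]
      refine (abs_real_inner_le_norm _ _).trans ?_
      gcongr
    have b3 : ‖∫ u, levyKernel (Real.exp (-s) • (2 * Real.pi) • w) u ∂ν‖ ≤
        ((2 * Real.pi * ‖w‖) ^ 2 + 2) * C := by
      rw [hC, ← integral_const_mul]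
      refine norm_integral_le_of_norm_le (hν.const_mul _) (ae_of_all _ fun u => ?_)
      refine (norm_levyKernel_le _ u).trans ?_
      gcongr
    rw [norm_mul, norm_mul]
    calc _ ≤ ‖H w‖ * (1 * (2 * Real.pi * ‖w‖ * ‖b - x‖ +
          ((2 * Real.pi * ‖w‖) ^ 2 + 2) * C)) := by
          gcongr
          exact (norm_add_le _ _).trans (add_le_add b2 b3)
      _ = _ := by ring

/-- Supplies the endpoint t = 0 for the fundamental theorem of calculus on (0, ∞), where only
one-sided continuity is required. -/
theorem continuousWithinAt_flowOp_zero {H : Rd d → ℂ} (hH : Continuous H)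
    (hHi : ∀ n : ℕ, Integrable fun w => ‖w‖ ^ n * ‖H w‖) (hψ : Continuous ψ)
    (hφ : ∀ t, 0 ≤ t → ∀ ξ, charFun (κ t) ξ = Complex.exp (ψ ξ - ψ (Real.exp (-t) • ξ)))
    (hrep : ∀ x, (h x : ℂ) =
      ∫ w, H w * Complex.exp (Complex.I * (inner ℝ ((2 * Real.pi) • w) x : ℝ))) (x : Rd d) :
    ContinuousWithinAt (fun t => flowOp κ h t x) (Ici 0) 0 := by
  have hc : ContinuousWithinAt (fun t => ∫ w, H w * flowMode ψ ((2 * Real.pi) • w) t x)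
      (Ici 0) 0 := by
    refine continuousWithinAt_of_dominated (bound := fun w => ‖H w‖) ?_ ?_
      (integrable_of_integrable_pow hH hHi).norm (ae_of_all _ fun w =>
        ((continuous_flowMode_time hψ _ x).const_mul _).continuousWithinAt)
    · filter_upwards [self_mem_nhdsWithin] with s hs
      exact (integrable_mul_flowMode κ hH hHi hψ (hφ s hs) x).aestronglyMeasurable
    · filter_upwards [self_mem_nhdsWithin] with s hs
      refine ae_of_all _ fun w => ?_
      rw [norm_mul]
      exact mul_le_of_le_one_right (norm_nonneg _) (norm_flowMode_le_one κ (hφ s hs) _ x)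
  have hre := Complex.continuous_re.continuousAt.comp_continuousWithinAt hc
  refine hre.congr (fun s hs => ?_) ?_
  · simp only [Function.comp_apply, ← flowOp_eq_integral_flowMode κ hH hHi (hφ s hs) hrep,
      Complex.ofReal_re]
  · simp only [Function.comp_apply, ← flowOp_eq_integral_flowMode κ hH hHi (hφ 0 le_rfl) hrep,
      Complex.ofReal_re]

end

end FourierModes

end

section

/-! ### The solution of the Stein equation -/

section SteinSolution

variable {d : ℕ}

theorem norm_iteratedFDeriv_le_of_supDeriv_le {l : ℕ} {f : Rd d → ℝ} (h : supDeriv l f ≤ 1)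
    (x : Rd d) : ‖iteratedFDeriv ℝ l f x‖ ≤ 1 :=
  ENNReal.ofReal_le_one.1
    ((le_iSup (fun x => ENNReal.ofReal ‖iteratedFDeriv ℝ l f x‖) x).trans h)

theorem supDeriv_le_ofReal {l : ℕ} {f : Rd d → ℝ} {C : ℝ}
    (h : ∀ x, ‖iteratedFDeriv ℝ l f x‖ ≤ C) : supDeriv l f ≤ ENNReal.ofReal C :=
  iSup_le fun x => ENNReal.ofReal_le_ofReal (h x)

theorem norm_iteratedFDeriv_two {f : Rd d → ℝ} (x : Rd d) :
    ‖iteratedFDeriv ℝ 2 f x‖ = ‖fderiv ℝ (fderiv ℝ f) x‖ := by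
  rw [← norm_iteratedFDeriv_fderiv, norm_iteratedFDeriv_one]

theorem classH_bounds {r : ℕ} (hr : 1 ≤ r) {h : Rd d → ℝ} (hh : h ∈ classH d r) :
    (∀ x, |h x| ≤ 1) ∧ (∀ x, HasFDerivAt h (fderiv ℝ h x) x) ∧ Continuous (fderiv ℝ h) ∧
      (∀ x, ‖fderiv ℝ h x‖ ≤ 1) ∧ ∀ x y, |h x - h y| ≤ ‖x - y‖ := by
  have hc : ContDiff ℝ 1 h := hh.1.of_le (by exact_mod_cast hr)
  have hd := contDiff_one_iff_fderiv.1 hc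
  have h1 : ∀ x, ‖fderiv ℝ h x‖ ≤ 1 := fun x => by
    have := norm_iteratedFDeriv_le_of_supDeriv_le (hh.2 1 hr) x
    rwa [norm_iteratedFDeriv_one] at this
  refine ⟨fun x => ?_, fun x => (hd.1 x).hasFDerivAt, hd.2, h1, fun x y => ?_⟩
  · have := norm_iteratedFDeriv_le_of_supDeriv_le (hh.2 0 (Nat.zero_le r)) x
    rwa [norm_iteratedFDeriv_zero] at this
  · have := Convex.norm_image_sub_le_of_norm_fderiv_le (𝕜 := ℝ) (f := h) (s := univ) (C := 1)
      (fun z _ => hd.1 z) (fun z _ => h1 z) convex_univ (mem_univ y) (mem_univ x)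
    simpa using this

theorem classH_two_bounds {h : Rd d → ℝ} (hh : h ∈ classH d 2) :
    (∀ x, HasFDerivAt (fderiv ℝ h) (fderiv ℝ (fderiv ℝ h) x) x) ∧
      Continuous (fderiv ℝ (fderiv ℝ h)) ∧ (∀ x, ‖fderiv ℝ (fderiv ℝ h) x‖ ≤ 1) ∧
      ∀ x y, ‖fderiv ℝ h x - fderiv ℝ h y‖ ≤ ‖x - y‖ := by
  have hc : ContDiff ℝ (1 + 1) h := by
    have := hh.1
    norm_num at this ⊢
    exact this
  have hd := contDiff_one_iff_fderiv.1 (contDiff_succ_iff_fderiv.1 hc).2.2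
  have h2 : ∀ x, ‖fderiv ℝ (fderiv ℝ h) x‖ ≤ 1 := fun x => by
    have := norm_iteratedFDeriv_le_of_supDeriv_le (hh.2 2 le_rfl) x
    rwa [norm_iteratedFDeriv_two] at this
  refine ⟨fun x => (hd.1 x).hasFDerivAt, hd.2, h2, fun x y => ?_⟩
  have := Convex.norm_image_sub_le_of_norm_fderiv_le (𝕜 := ℝ) (f := fderiv ℝ h) (s := univ)
    (C := 1) (fun z _ => hd.1 z) (fun z _ => h2 z) convex_univ (mem_univ y) (mem_univ x)
  simpa using this

variable (κ : ProbabilityTheory.Kernel ℝ (Rd d)) [hκ : ProbabilityTheory.IsMarkovKernel κ]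

theorem norm_flowOp_sub_le {F : Type*} [NormedAddCommGroup F] [NormedSpace ℝ F] {g : Rd d → F}
    (hg : Continuous g) {B : ℝ} (hB : ∀ x, ‖g x‖ ≤ B) (hL : ∀ x y, ‖g x - g y‖ ≤ ‖x - y‖)
    (t : ℝ) (x y : Rd d) :
    ‖flowOp κ g t x - flowOp κ g t y‖ ≤ Real.exp (-t) * ‖x - y‖ := by
  rw [flowOp, flowOp, ← integral_sub (integrable_flowOp κ hg hB t x) (integrable_flowOp κ hg hB t y)]
  have : ∀ z, ‖g (Real.exp (-t) • x + z) - g (Real.exp (-t) • y + z)‖ ≤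
      Real.exp (-t) * ‖x - y‖ := fun z => by
    refine (hL _ _).trans_eq ?_
    rw [add_sub_add_right_eq_sub, ← smul_sub, norm_smul, Real.norm_of_nonneg (Real.exp_pos _).le]
  simpa using norm_integral_le_of_norm_le_const (μ := κ t) (ae_of_all _ this)

variable {h : Rd d → ℝ} {c ε : ℝ} {K : Rd d → ℝ}

theorem integrableOn_flowOp_sub (hε : 0 < ε) (hc : Continuous h)
    (hdec : ∀ t, 0 ≤ t → ∀ x, |flowOp κ h t x - c| ≤ K x * Real.exp (-(ε * t))) (x : Rd d) :
    IntegrableOn (fun t => flowOp κ h t x - c) (Ioi 0) := by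
  have he : IntegrableOn (fun t : ℝ => Real.exp (-(ε * t))) (Ioi 0) := by
    have := exp_neg_integrableOn_Ioi 0 hε
    simpa only [neg_mul] using this
  refine (he.const_mul (K x)).mono'
    ((stronglyMeasurable_flowOp_left κ hc x).sub stronglyMeasurable_const).aestronglyMeasurable ?_
  filter_upwards [ae_restrict_mem measurableSet_Ioi] with t ht
  exact hdec t (le_of_lt ht) x

/-- The function `-∫_0^∞ (P_t h - c) dt`. -/
def flowSol (κ : ProbabilityTheory.Kernel ℝ (Rd d)) (h : Rd d → ℝ) (c : ℝ) (x : Rd d) : ℝ :=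
  -∫ t in Ioi (0 : ℝ), (flowOp κ h t x - c)

/-- The derivative of `flowSol`. -/
def flowSolDeriv (κ : ProbabilityTheory.Kernel ℝ (Rd d)) (h : Rd d → ℝ) (x : Rd d) :
    Rd d →L[ℝ] ℝ :=
  -∫ t in Ioi (0 : ℝ), Real.exp (-((1 : ℕ) * t)) • flowOp κ (fderiv ℝ h) t x

theorem hasFDerivAt_flowSol {r : ℕ} (hr : 1 ≤ r) (hh : h ∈ classH d r)
    (hi : ∀ x, IntegrableOn (fun t => flowOp κ h t x - c) (Ioi 0)) (x : Rd d) :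
    HasFDerivAt (flowSol κ h c) (flowSolDeriv κ h x) x := by
  obtain ⟨b0, b1, b2, b3, -⟩ := classH_bounds hr hh
  have := hasFDerivAt_integral_exp_smul_flowOp κ 0 b1 b2 b0 b3 c
    (fun x => by simpa using hi x) x
  simp only [Nat.cast_zero, zero_mul, neg_zero, Real.exp_zero, one_smul, zero_add] at this
  exact this.neg

theorem fderiv_flowSol {r : ℕ} (hr : 1 ≤ r) (hh : h ∈ classH d r)
    (hi : ∀ x, IntegrableOn (fun t => flowOp κ h t x - c) (Ioi 0)) :
    fderiv ℝ (flowSol κ h c) = flowSolDeriv κ h :=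
  funext fun x => (hasFDerivAt_flowSol κ hr hh hi x).fderiv

theorem contDiff_one_flowSol {r : ℕ} (hr : 1 ≤ r) (hh : h ∈ classH d r)
    (hi : ∀ x, IntegrableOn (fun t => flowOp κ h t x - c) (Ioi 0)) :
    ContDiff ℝ 1 (flowSol κ h c) ∧ supDeriv 1 (flowSol κ h c) ≤ 1 := by
  obtain ⟨b0, b1, b2, b3, -⟩ := classH_bounds hr hh
  have hD := fderiv_flowSol κ hr hh hi
  refine ⟨contDiff_one_iff_fderiv.2
    ⟨fun x => (hasFDerivAt_flowSol κ hr hh hi x).differentiableAt, ?_⟩, ?_⟩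
  · rw [hD]
    exact (continuous_integral_exp_smul_flowOp κ le_rfl b2 b3).neg
  · rw [← ENNReal.ofReal_one]
    refine supDeriv_le_ofReal fun x => ?_
    rw [norm_iteratedFDeriv_one, hD, flowSolDeriv, norm_neg]
    exact (norm_integral_exp_smul_flowOp_le κ le_rfl b3 x).trans_eq (by simp)

theorem hasFDerivAt_flowSolDeriv (hh : h ∈ classH d 2) (x : Rd d) :
    HasFDerivAt (flowSolDeriv κ h)
      (-∫ t in Ioi (0 : ℝ), Real.exp (-((2 : ℕ) * t)) • flowOp κ (fderiv ℝ (fderiv ℝ h)) t x)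
      x := by
  obtain ⟨b0, b1, b2, b3, -⟩ := classH_bounds one_le_two hh
  obtain ⟨c1, c2, c3, -⟩ := classH_two_bounds hh
  have := hasFDerivAt_integral_exp_smul_flowOp κ 1 c1 c2 b3 c3 0
    (fun x => by simpa using integrableOn_exp_smul_flowOp κ le_rfl b2 b3 x) x
  simp only [sub_zero] at this
  exact this.neg

theorem contDiff_two_flowSol (hh : h ∈ classH d 2)
    (hi : ∀ x, IntegrableOn (fun t => flowOp κ h t x - c) (Ioi 0)) :
    ContDiff ℝ 2 (flowSol κ h c) ∧ supDeriv 2 (flowSol κ h c) ≤ 1 / 2 := by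
  obtain ⟨c1, c2, c3, -⟩ := classH_two_bounds hh
  have hD := fderiv_flowSol κ one_le_two hh hi
  have hD2 : fderiv ℝ (flowSolDeriv κ h) = _ :=
    funext fun x => (hasFDerivAt_flowSolDeriv κ hh x).fderiv
  constructor
  · have : ContDiff ℝ (1 + 1) (flowSol κ h c) := by
      refine contDiff_succ_iff_fderiv.2
        ⟨fun x => (hasFDerivAt_flowSol κ one_le_two hh hi x).differentiableAt, by simp, ?_⟩
      rw [hD, contDiff_one_iff_fderiv]
      refine ⟨fun x => (hasFDerivAt_flowSolDeriv κ hh x).differentiableAt, ?_⟩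
      rw [hD2]
      exact (continuous_integral_exp_smul_flowOp κ one_le_two c2 c3).neg
    norm_num at this
    exact this
  · have h12 : (1 / 2 : ℝ≥0∞) = ENNReal.ofReal (1 / 2) := by
      rw [ENNReal.ofReal_div_of_pos two_pos]
      simp
    rw [h12]
    refine supDeriv_le_ofReal fun x => ?_
    rw [norm_iteratedFDeriv_two, hD, hD2]
    have hle := norm_integral_exp_smul_flowOp_le κ (g := fderiv ℝ (fderiv ℝ h)) one_le_two c3 x
    norm_num only [mul_one] at hle
    exact (@norm_neg (Rd d →L[ℝ] Rd d →L[ℝ] ℝ) _ _).trans_le hle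

/-! ### The Stein equation -/

/-- The compensated jumps of `P_t h` at `x`, as a function of `(t, u)`. -/
def flowJump (κ : ProbabilityTheory.Kernel ℝ (Rd d)) (h : Rd d → ℝ) (x : Rd d)
    (p : ℝ × Rd d) : ℝ :=
  flowOp κ h p.1 (x + p.2) - flowOp κ h p.1 x -
    if ‖p.2‖ ≤ 1 then (Real.exp (-p.1) • flowOp κ (fderiv ℝ h) p.1 x) p.2 else 0

theorem measurable_flowJump (hh : h ∈ classH d 2) (x : Rd d) : Measurable (flowJump κ h x) := by
  obtain ⟨b0, b1, b2, b3, -⟩ := classH_bounds one_le_two hh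
  have hc : Continuous h := hh.1.continuous
  have m1 : Measurable fun p : ℝ × Rd d => flowOp κ h p.1 (x + p.2) :=
    (stronglyMeasurable_flowOp κ hc).measurable.comp
      (g := fun p : ℝ × Rd d => flowOp κ h p.1 p.2)
      (f := fun p : ℝ × Rd d => (p.1, x + p.2)) (by fun_prop)
  have m2 : Measurable fun p : ℝ × Rd d => flowOp κ h p.1 x :=
    (stronglyMeasurable_flowOp_left κ hc x).measurable.comp measurable_fst
  have m3 : StronglyMeasurable fun p : ℝ × Rd d =>
      Real.exp (-p.1) • flowOp κ (fderiv ℝ h) p.1 x :=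
    (by fun_prop : Measurable fun p : ℝ × Rd d => Real.exp (-p.1)).stronglyMeasurable.smul
      ((stronglyMeasurable_flowOp_left κ b2 x).comp_measurable measurable_fst)
  have m4 : Measurable fun p : ℝ × Rd d =>
      (Real.exp (-p.1) • flowOp κ (fderiv ℝ h) p.1 x) p.2 :=
    (isBoundedBilinearMap_apply.continuous.comp_stronglyMeasurable
      (m3.prodMk measurable_snd.stronglyMeasurable)).measurable
  exact (m1.sub m2).sub (Measurable.ite (measurableSet_le (by fun_prop) measurable_const) m4
    measurable_const)

/-- Small jumps are controlled by the Lipschitz constant e^{-2t} of D(P_t h): one factor e^{-t}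
comes from differentiating, the other from the contraction inside Dh. Large jumps use |P_t h| ≤ 1
and the Lipschitz constant e^{-t} of P_t h. -/
theorem abs_flowJump_le (hh : h ∈ classH d 2) (x : Rd d) {t : ℝ} (ht : 0 ≤ t) (u : Rd d) :
    |flowJump κ h x (t, u)| ≤ 2 * flowBound (t, u) := by
  obtain ⟨b0, b1, b2, b3, b4⟩ := classH_bounds one_le_two hh
  obtain ⟨c1, c2, c3, c4⟩ := classH_two_bounds hh
  have hc : Continuous h := hh.1.continuous
  have he := Real.exp_pos (-t)
  unfold flowJump
  refine le_flowBound ht two_pos.le (fun hu => ?_) (fun hu => ?_) (fun hu => ?_)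
  · simp only [hu, if_true]
    refine (norm_sub_sub_fderiv_le (hasFDerivAt_flowOp κ b1 b2 b0 b3 t)
      (L := Real.exp (-t) ^ 2) (by positivity) (fun y z => ?_) x u).trans ?_
    · rw [← smul_sub, norm_smul, Real.norm_of_nonneg he.le, sq, mul_assoc]
      exact mul_le_mul_of_nonneg_left (norm_flowOp_sub_le κ b2 b3 c4 t z y) he.le
    · rw [mul_pow]
      have : 0 ≤ Real.exp (-t) ^ 2 * ‖u‖ ^ 2 := by positivity
      linarith
  · simp only [not_le.2 hu, if_false, sub_zero]
    refine (abs_sub _ _).trans ?_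
    have := norm_flowOp_le κ (g := h) b0 t (x + u)
    have := norm_flowOp_le κ (g := h) b0 t x
    simp only [Real.norm_eq_abs] at *
    linarith
  · simp only [not_le.2 hu, if_false, sub_zero]
    have := norm_flowOp_sub_le κ hc b0 b4 t (x + u) x
    rw [add_sub_cancel_left, Real.norm_eq_abs] at this
    have h0 : 0 ≤ Real.exp (-t) * ‖u‖ := by positivity
    linarith

theorem integrable_flowJump (hh : h ∈ classH d 2) {ν : Measure (Rd d)} [SFinite ν]
    (hν : Integrable flowBound ((volume.restrict (Ioi (0 : ℝ))).prod ν)) (x : Rd d) :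
    Integrable (flowJump κ h x) ((volume.restrict (Ioi (0 : ℝ))).prod ν) := by
  refine (hν.const_mul 2).mono' (measurable_flowJump κ hh x).aestronglyMeasurable ?_
  filter_upwards [ae_fst_pos] with p hp
  exact abs_flowJump_le κ hh x hp.le p.2

theorem flowSolDeriv_apply (hh : h ∈ classH d 2) (x v : Rd d) :
    IntegrableOn (fun t => (Real.exp (-t) • flowOp κ (fderiv ℝ h) t x) v) (Ioi 0) ∧
      flowSolDeriv κ h x v =
        -∫ t in Ioi (0 : ℝ), (Real.exp (-t) • flowOp κ (fderiv ℝ h) t x) v := by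
  obtain ⟨b0, b1, b2, b3, -⟩ := classH_bounds one_le_two hh
  have hi := integrableOn_exp_smul_flowOp κ le_rfl b2 b3 x
  rw [flowSolDeriv, neg_apply, ContinuousLinearMap.integral_apply hi]
  simp only [Nat.cast_one, one_mul] at hi ⊢
  exact ⟨hi.apply_continuousLinearMap v, trivial⟩

/-- The constant c cancels in the increment, and the gradient of the solution is itself a time
integral. -/
theorem jumpTerm_flowSol (hh : h ∈ classH d 2)
    (hi : ∀ x, IntegrableOn (fun t => flowOp κ h t x - c) (Ioi 0)) (x u : Rd d) :
    jumpTerm (flowSol κ h c) x u = -∫ t in Ioi (0 : ℝ), flowJump κ h x (t, u) := by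
  obtain ⟨ha, hb⟩ := flowSolDeriv_apply κ hh x u
  have hi2 : IntegrableOn (fun t => flowOp κ h t (x + u) - flowOp κ h t x) (Ioi 0) := by
    refine ((hi (x + u)).sub (hi x)).congr (ae_of_all _ fun t => ?_)
    simp
  have h1 : flowSol κ h c (x + u) - flowSol κ h c x =
      -∫ t in Ioi (0 : ℝ), (flowOp κ h t (x + u) - flowOp κ h t x) := by
    rw [flowSol, flowSol, neg_sub_neg, ← neg_sub, ← integral_sub (hi (x + u)) (hi x)]
    simp only [sub_sub_sub_cancel_right]
  rw [jumpTerm, h1, inner_gradient_left, fderiv_flowSol κ one_le_two hh hi]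
  unfold flowJump
  by_cases hu : ‖u‖ ≤ 1
  · simp only [hu, if_true]
    rw [hb, integral_sub hi2 ha]
    ring
  · simp [hu]

/-- The Kolmogorov equation is integrated over (0, ∞): the left side is c - h(x), and the right side
is minus the generator applied to the solution, after exchanging the integrals in t and u. -/
theorem stein_equation_flowSol (hκ0 : κ 0 = Measure.dirac 0) {ψ : Rd d → ℂ} (hψ : Continuous ψ)
    (hφ : ∀ t, 0 ≤ t → ∀ ξ, charFun (κ t) ξ = Complex.exp (ψ ξ - ψ (Real.exp (-t) • ξ)))
    {b : Rd d} {ν : Measure (Rd d)} [SFinite ν] (hν : Integrable (fun u => min 1 (‖u‖ ^ 2)) ν)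
    (hνf : Integrable flowBound ((volume.restrict (Ioi (0 : ℝ))).prod ν))
    (hψd : ∀ ξ t, HasDerivAt (fun t => ψ (Real.exp (-t) • ξ))
      (-levyExponent b ν (Real.exp (-t) • ξ)) t)
    (hε : 0 < ε) (hdec : ∀ t, 0 ≤ t → ∀ x, |flowOp κ h t x - c| ≤ K x * Real.exp (-(ε * t)))
    (hh : h ∈ classH d 2) (hs : ContDiff ℝ (⊤ : ℕ∞) h) (hcs : HasCompactSupport h) (x : Rd d) :
    Integrable (jumpTerm (flowSol κ h c) x) ν ∧
      inner ℝ (b - x) (gradient (flowSol κ h c) x) + ∫ u, jumpTerm (flowSol κ h c) x u ∂ν =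
        h x - c := by
  obtain ⟨b0, b1, b2, b3, -⟩ := classH_bounds one_le_two hh
  have hi := integrableOn_flowOp_sub κ hε hh.1.continuous hdec
  have hJ := integrable_flowJump κ hh hνf x
  have hjt : jumpTerm (flowSol κ h c) x = fun u => -∫ t in Ioi (0 : ℝ), flowJump κ h x (t, u) :=
    funext fun u => jumpTerm_flowSol κ hh hi x u
  refine ⟨by rw [hjt]; exact hJ.integral_prod_right.neg, ?_⟩
  obtain ⟨ha, hb⟩ := flowSolDeriv_apply κ hh x (b - x)
  obtain ⟨H, hH, hHi, hrep⟩ := exists_fourier_representation hs hcs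
  have hder : ∀ t ∈ Ioi (0 : ℝ), HasDerivAt (fun t => flowOp κ h t x)
      ((Real.exp (-t) • flowOp κ (fderiv ℝ h) t x) (b - x) +
        ∫ u, flowJump κ h x (t, u) ∂ν) t := fun t ht =>
    hasDerivAt_flowOp_time κ hH hHi hψ hφ hrep hν hψd ht (hasFDerivAt_flowOp κ b1 b2 b0 b3 t x)
  have hlim : Tendsto (fun t => flowOp κ h t x) atTop (𝓝 c) := by
    rw [tendsto_iff_norm_sub_tendsto_zero]
    have hexp : Tendsto (fun t : ℝ => K x * Real.exp (-(ε * t))) atTop (𝓝 0) := by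
      have := (Real.tendsto_exp_neg_atTop_nhds_zero.comp
        (tendsto_id.const_mul_atTop hε)).const_mul (K x)
      simpa [Function.comp_def] using this
    refine squeeze_zero' (Eventually.of_forall fun t => norm_nonneg _) ?_ hexp
    filter_upwards [Ici_mem_atTop (0 : ℝ)] with t ht
    exact hdec t ht x
  -- The time derivative is integrable: its drift part carries e^{-t}, and its jump part is a
  -- marginal of the jointly integrable `flowJump`.
  have hftc := integral_Ioi_of_hasDerivAt_of_tendsto
    (continuousWithinAt_flowOp_zero κ hH hHi hψ hφ hrep x) hder
    (ha.add hJ.integral_prod_left) hlim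
  have h0 : flowOp κ h 0 x = h x := by
    rw [flowOp, hκ0, integral_dirac]
    simp
  rw [integral_add ha hJ.integral_prod_left, h0] at hftc
  rw [hjt, integral_neg, real_inner_comm, inner_gradient_left,
    fderiv_flowSol κ one_le_two hh hi, hb,
    ← integral_integral_swap (f := fun t u => flowJump κ h x (t, u)) hJ]
  linarith

end SteinSolution

end

end

/-! ### Assembly of the theorem. -/

theorem mainTheorem6 (d : ℕ) (hd : 1 ≤ d)
    -- the law of `X`, its parameters `b`, `ν` (polar decomposition through `σ` and `k`)
    (μX : Measure (Rd d)) (b : Rd d) (σ : Measure (Sph d)) (hσ : IsFiniteMeasure σ)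
    (k : KFunction d)
    (hX : IsID μX b 0 (polarLevy σ k)) (hnd : IsNondegenerate μX)
    -- the moment condition and the decay conditions
    (ε : ℝ) (hε : ε ∈ Ioo (0 : ℝ) 1) (hmom : ∫⁻ x, ENNReal.ofReal (‖x‖ ^ ε) ∂μX < ⊤)
    (β₁ β₂ β₃ : ℝ) (hβ₁ : 0 < β₁) (hβ₂ : 0 < β₂) (hβ₃ : β₃ ∈ Ioo (0 : ℝ) 1)
    (hγ₁ : gammaOne σ k β₁ < ⊤) (hγ₂ : gammaTwo σ k β₂ < ⊤) (hγ₃ : gammaThree σ k β₃ < ⊤)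
    -- the laws `μ t` of the random vectors `X_t`, with uniformly bounded `ε`-moments
    (μ : ℝ → Measure (Rd d)) (hμ : ∀ t, 0 ≤ t → IsProbabilityMeasure (μ t))
    (hφ : ∀ t, 0 ≤ t → ∀ ξ, charFun (μ t) ξ = phiT b σ k t ξ)
    (hunif : (⨆ t : ℝ, ⨆ _ : 0 ≤ t, ∫⁻ y, ENNReal.ofReal (‖y‖ ^ ε) ∂(μ t)) < ⊤) :
    (∀ h ∈ classH d 1,
      (∀ x, IntegrableOn (fun t => semigroupP μ t h x - ∫ z, h z ∂μX) (Ioi 0)) ∧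
      ContDiff ℝ 1 (steinSol μX μ h) ∧
      supDeriv 1 (steinSol μX μ h) ≤ 1) ∧
    (∀ h ∈ classH d 2, ContDiff ℝ (⊤ : ℕ∞) h → HasCompactSupport h →
      ContDiff ℝ 2 (steinSol μX μ h) ∧
      supDeriv 2 (steinSol μX μ h) ≤ 1 / 2 ∧
      ∀ x, Integrable (jumpTerm (steinSol μX μ h) x) (tildeLevy σ k) ∧
        inner ℝ (tildeDrift b σ k - x) (gradient (steinSol μX μ h) x) +
          ∫ u, jumpTerm (steinSol μX μ h) x u ∂(tildeLevy σ k) =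
        h x - ∫ z, h z ∂μX) := by
  have hprob := hX.1
  have hlevy := hX.2.2.1
  have hν := integrable_min_one_sq_polarLevy σ k hlevy
  have hνt := integrable_min_one_sq_tildeLevy σ k hlevy
  have hmap := map_prod_tildeLevy σ k
  have hψ := continuous_levyExponent b hν
  have hXψ := charFun_eq_exp_levyExponent hX
  have hφψ : ∀ t, 0 ≤ t → ∀ ξ, charFun (μ t) ξ =
      Complex.exp (levyExponent b (polarLevy σ k) ξ -
        levyExponent b (polarLevy σ k) (Real.exp (-t) • ξ)) := fun t ht ξ =>
    (hφ t ht ξ).trans (phiT_eq_exp_sub σ k hlevy b ht ξ)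
  obtain ⟨κ, hκ, hκμ⟩ := exists_kernel_of_exponent hμ hψ hφψ
  have hsemi : ∀ t, 0 ≤ t → ∀ (h : Rd d → ℝ) x, semigroupP μ t h x = flowOp κ h t x := by
    intro t ht h x
    rw [semigroupP, flowOp, hκμ t ht]
  have hsol : ∀ h : Rd d → ℝ, steinSol μX μ h = flowSol κ h (∫ z, h z ∂μX) := by
    intro h
    ext x
    rw [steinSol, flowSol]
    congr 1
    exact setIntegral_congr_fun measurableSet_Ioi fun t ht => by
      simp only [hsemi t (le_of_lt ht)]
  have hdec : ∀ r, 1 ≤ r → ∀ h ∈ classH d r, ∀ t, 0 ≤ t → ∀ x,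
      |flowOp κ h t x - ∫ z, h z ∂μX| ≤
        (2 * ∫ z, ‖x - z‖ ^ ε ∂μX) * Real.exp (-(ε * t)) := by
    intro r hr h hh t ht x
    obtain ⟨b0, -, -, -, b4⟩ := classH_bounds hr hh
    rw [← hsemi t ht]
    exact abs_semigroupP_sub_le hXψ hμ hφψ hε hmom b0 b4 hh.1.continuous ht x
  refine ⟨fun h hh => ?_, fun h hh hs hcs => ?_⟩
  · have hi := integrableOn_flowOp_sub κ hε.1 hh.1.continuous (hdec 1 le_rfl h hh)
    rw [hsol]
    refine ⟨fun x => (hi x).congr_fun (fun t ht => ?_) measurableSet_Ioi,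
      contDiff_one_flowSol κ le_rfl hh hi⟩
    simp only [hsemi t (le_of_lt ht)]
  · have hi := integrableOn_flowOp_sub κ hε.1 hh.1.continuous (hdec 2 one_le_two h hh)
    rw [hsol]
    obtain ⟨h1, h2⟩ := contDiff_two_flowSol κ hh hi
    have h0 : κ 0 = Measure.dirac 0 :=
      (hκμ 0 le_rfl).trans (eq_dirac_zero_of_exponent hμ hφψ)
    exact ⟨h1, h2, fun x => stein_equation_flowSol κ h0 hψ
      (fun t ht ξ => by rw [hκμ t ht, hφψ t ht]) hνt (integrable_flowBound hmap hν)
      (hasDerivAt_levyExponent_flow hmap hν (inner_drift σ k hlevy b)) hε.1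
      (hdec 2 one_le_two h hh) hh hs hcs x⟩
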